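/- Let $S$ be a Noetherian Jacobson scheme. An \emph{$S$-scheme} is a separated scheme together with a morphism of finite type to $S$. A \emph{fat point} is a finite $S$-scheme with exactly one point. A \emph{sieve} on an $S$-scheme $X$ is a subfunctor of the contravariant functor $X^\circ\colon\mathfrak z\mapsto\mathrm{Hom}_S(\mathfrak z,X)$ on the category of fat points; unions and intersections of sieves are taken pointwise. A closed subscheme $Y\subseteq X$ defines the \emph{closed subsieve} $Y^\circ\subseteq X^\circ$, and a \emph{Zariski motive} on $X$ is a (possibly empty) finite union of closed subsieves on $X$; these form a lattice. A natural transformation $\mathfrak X\to\mathfrak Y$ between Zariski motives on $X$ and on $Y$ is \emph{explicit} if there are a locally closed subscheme $V\subseteq X$ with $\mathfrak X\subseteq V^\circ$ and a morphism of $S$-schemes $\varphi\colon V\to Y$ such that it is the restriction of $\varphi^\circ$ to $\mathfrak X$. Two Zariski motives are isomorphic if there are mutually inverse explicit morphisms between them. The additive group of the Zariski Grothendieck ring of $S$ is the free abelian group on the Zariski motives on all $S$-schemes, modulo the scissor relations $\langle\mathfrak X\rangle+\langle\mathfrak Y\rangle-\langle\mathfrak X\cup\mathfrak Y\rangle-\langle\mathfrak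 X\cap\mathfrak Y\rangle$ for any two Zariski motives $\mathfrak X,\mathfrak Y$ on a common $S$-scheme, the relations $\langle\mathfrak X\rangle-\langle\mathfrak Y\rangle$ for isomorphic Zariski motives, and $\langle\emptyset\rangle=0$. The class $[X]$ of an $S$-scheme $X$ is the class of $X^\circ$. A point $x\in X$ is \emph{associated} if every element of $\mathcal O_{X,x}$ is a unit or a zero-divisor, and $X$ is \emph{strongly connected} if the closures of its associated points (its primary components) have a common point. \textbf{Theorem.} The additive group of the Zariski Grothendieck ring of $S$ is free abelian, with basis the classes $[X]$, where $X$ runs over the isomorphism classes of strongly connected $S$-schemes. Consequently, if $X$ and $Y$ are strongly connected $S$-schemes, then $[X]=[Y]$ if and only if $X\cong Y$ over $S$. -/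

import Mathlib

open CategoryTheory AlgebraicGeometry Opposite

universe u

noncomputable section

namespace Motivic

/-- An `S`-scheme: a separated scheme together with a morphism of finite type to `S`. -/
def isSScheme (S : Scheme.{u}) : ObjectProperty (Over S) := fun X =>
  X.left.IsSeparated ∧ LocallyOfFiniteType X.hom ∧ QuasiCompact X.hom

/-- The category of `S`-schemes. -/
abbrev SSch (S : Scheme.{u}) := (isSScheme S).FullSubcategory

/-- A fat `S`-point: a finite morphism to `S` from a scheme having a unique point. -/
def isFatPoint (S : Scheme.{u}) : ObjectProperty (Over S) := fun T =>
  IsFinite T.hom ∧ Nonempty (Unique T.left)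

/-- The category of fat `S`-points. -/
abbrev FatPt (S : Scheme.{u}) := (isFatPoint S).FullSubcategory

/-- The presheaf `T ↦ X(T)` of rational points of an `S`-scheme, on the category of fat points. -/
def pts {S : Scheme.{u}} (X : SSch S) : (FatPt S)ᵒᵖ ⥤ Type u :=
  (isFatPoint S).ι.op ⋙ yoneda.obj X.obj

/-- The natural transformation `X(T) → Y(T)`, `a ↦ a ≫ φ`, induced by a morphism `φ : X ⟶ Y`. -/
def ptsMap {S : Scheme.{u}} {X Y : SSch S} (φ : X ⟶ Y) : pts X ⟶ pts Y :=
  Functor.whiskerLeft (isFatPoint S).ι.op (yoneda.map φ.hom)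

/-- A sieve on `X`: a subpresheaf of the presheaf of rational points of `X`. These form a
complete lattice, with pointwise unions and intersections. -/
abbrev SieveOn {S : Scheme.{u}} (X : SSch S) := Subfunctor (pts X)

/-- The image sieve of a morphism `φ : Y ⟶ X`: the rational points of `X` that factor through `φ`.
When `φ` is a closed immersion, this is the closed subsieve on `X` given by `Y`. -/
def im {S : Scheme.{u}} {X Y : SSch S} (φ : Y ⟶ X) : SieveOn X :=
  Subfunctor.range (ptsMap φ)

/-- A Zariski motive on `X`: a finite (possibly empty) union of closed subsieves on `X`. -/
def IsZariski {S : Scheme.{u}} {X : SSch S} (A : SieveOn X) : Prop :=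
  ∃ (ι : Type) (_ : Finite ι) (Y : ι → SSch S) (i : ∀ k, Y k ⟶ X),
    (∀ k, IsClosedImmersion (i k).hom.left) ∧ A = ⨆ k, im (i k)

lemma mem_im {S : Scheme.{u}} {X Y : SSch S} (φ : Y ⟶ X) (T : (FatPt S)ᵒᵖ)
    (a : T.unop.obj ⟶ X.obj) :
    a ∈ (im φ).obj T ↔ ∃ b : T.unop.obj ⟶ Y.obj, b ≫ φ.hom = a := Iff.rfl

lemma isZariski_bot {S : Scheme.{u}} (X : SSch S) : IsZariski (⊥ : SieveOn X) :=
  ⟨PEmpty, inferInstance, fun k => k.elim, fun k => k.elim, fun k => k.elim,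
    (iSup_of_empty _).symm⟩

lemma isZariski_top {S : Scheme.{u}} (X : SSch S) : IsZariski (⊤ : SieveOn X) := by
  refine ⟨PUnit, inferInstance, fun _ => X, fun _ => 𝟙 X, fun _ => ?_, ?_⟩
  · change IsClosedImmersion (𝟙 X.obj.left)
    infer_instance
  · rw [iSup_const]
    refine le_antisymm (fun T a _ => ?_) le_top
    exact ⟨a, Category.comp_id (X := T.unop.obj) (Y := X.obj) a⟩

lemma isZariski_sup {S : Scheme.{u}} {X : SSch S} {A B : SieveOn X}
    (hA : IsZariski A) (hB : IsZariski B) : IsZariski (A ⊔ B) := by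
  obtain ⟨ι, _, Y, i, hi, rfl⟩ := hA
  obtain ⟨κ, _, Z, j, hj, rfl⟩ := hB
  refine ⟨ι ⊕ κ, inferInstance, Sum.elim Y Z, fun k => Sum.rec i j k, ?_, ?_⟩
  · rintro (k | k)
    · exact hi k
    · exact hj k
  · exact (iSup_sum (f := fun k : ι ⊕ κ => im (Sum.rec (motive := fun k =>
      Sum.elim Y Z k ⟶ X) i j k))).symm

/-- The intersection of two closed subsieves is the closed subsieve of the scheme-theoretic
intersection. -/
lemma exists_im_inf {S : Scheme.{u}} {X Y Z : SSch S} (i : Y ⟶ X) (j : Z ⟶ X)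
    (hi : IsClosedImmersion i.hom.left) (hj : IsClosedImmersion j.hom.left) :
    ∃ (W : SSch S) (l : W ⟶ X), IsClosedImmersion l.hom.left ∧ im i ⊓ im j = im l := by
  have hc : IsClosedImmersion (Limits.pullback.fst i.hom.left j.hom.left ≫ i.hom.left) :=
    inferInstance
  let W : Over S := Over.mk ((Limits.pullback.fst i.hom.left j.hom.left ≫ i.hom.left) ≫ X.obj.hom)
  have hW : isSScheme S W := by
    obtain ⟨h1, h2, h3⟩ := X.property
    refine ⟨?_, ?_, ?_⟩
    · have : (Limits.pullback i.hom.left j.hom.left).IsSeparated := by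
        constructor
        rw [← Limits.terminal.comp_from
          (Limits.pullback.fst i.hom.left j.hom.left ≫ i.hom.left)]
        infer_instance
      exact this
    · change LocallyOfFiniteType
        ((Limits.pullback.fst i.hom.left j.hom.left ≫ i.hom.left) ≫ X.obj.hom)
      infer_instance
    · change QuasiCompact
        ((Limits.pullback.fst i.hom.left j.hom.left ≫ i.hom.left) ≫ X.obj.hom)
      infer_instance
  let l : W ⟶ X.obj := Over.homMk (Limits.pullback.fst i.hom.left j.hom.left ≫ i.hom.left) rfl
  refine ⟨⟨W, hW⟩, ⟨l⟩, hc, ?_⟩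
  ext T a
  change (_ ∧ _) ↔ _
  change T.unop.obj ⟶ X.obj at a
  constructor
  · rintro ⟨⟨b, hb⟩, ⟨c, hc'⟩⟩
    change T.unop.obj ⟶ Y.obj at b
    change T.unop.obj ⟶ Z.obj at c
    change b ≫ i.hom = a at hb
    change c ≫ j.hom = a at hc'
    have hb' : b.left ≫ i.hom.left = a.left := by rw [← hb]; rfl
    have hc'' : c.left ≫ j.hom.left = a.left := by rw [← hc']; rfl
    have hw : Limits.pullback.lift b.left c.left (hb'.trans hc''.symm) ≫
        (Limits.pullback.fst i.hom.left j.hom.left ≫ i.hom.left) = a.left := by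
      rw [← Category.assoc, Limits.pullback.lift_fst, hb']
    refine (mem_im _ _ _).2 ⟨Over.homMk (Limits.pullback.lift b.left c.left
      (hb'.trans hc''.symm)) ?_, ?_⟩
    · change _ ≫ (Limits.pullback.fst i.hom.left j.hom.left ≫ i.hom.left) ≫ X.obj.hom = _
      rw [← Category.assoc, hw]
      exact Over.w a
    · ext1
      exact hw
  · intro h
    obtain ⟨b, hb⟩ := (mem_im _ _ _).1 h
    change b ≫ l = a at hb
    have hb' : b.left ≫ (Limits.pullback.fst i.hom.left j.hom.left ≫ i.hom.left) = a.left := by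
      rw [← hb]; rfl
    constructor
    · refine (mem_im _ _ _).2 ⟨Over.homMk (b.left ≫ Limits.pullback.fst _ _) ?_, ?_⟩
      · rw [← Over.w a, ← hb', ← Over.w i.hom]
        simp
      · ext1
        refine Eq.trans ?_ hb'
        exact Category.assoc _ _ _
    · refine (mem_im _ _ _).2 ⟨Over.homMk (b.left ≫ Limits.pullback.snd _ _) ?_, ?_⟩
      · rw [← Over.w a, ← hb', ← Over.w j.hom, Limits.pullback.condition]
        simp
      · ext1
        refine Eq.trans (Category.assoc _ _ _) (Eq.trans ?_ hb')
        exact congrArg (fun f => b.left ≫ f) Limits.pullback.condition.symm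

lemma isZariski_inf {S : Scheme.{u}} {X : SSch S} {A B : SieveOn X}
    (hA : IsZariski A) (hB : IsZariski B) : IsZariski (A ⊓ B) := by
  obtain ⟨ι, _, Y, i, hi, rfl⟩ := hA
  obtain ⟨κ, _, Z, j, hj, rfl⟩ := hB
  choose W l hl hW using fun p : ι × κ => exists_im_inf (i p.1) (j p.2) (hi p.1) (hj p.2)
  refine ⟨ι × κ, inferInstance, W, l, hl, ?_⟩
  ext T a
  simp only [← hW, Subfunctor.min_obj, Subfunctor.iSup_obj, Set.mem_inter_iff, Set.mem_iUnion,
    Prod.exists]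
  exact ⟨fun ⟨⟨k, hk⟩, m, hm⟩ => ⟨k, m, hk, hm⟩, fun ⟨k, m, hk, hm⟩ => ⟨⟨k, hk⟩, m, hm⟩⟩

/-- The lattice of Zariski motives on `X`. -/
def zariskiOn {S : Scheme.{u}} (X : SSch S) : Sublattice (SieveOn X) where
  carrier := {A | IsZariski A}
  supClosed' := fun _ hA _ hB => isZariski_sup hA hB
  infClosed' := fun _ hA _ hB => isZariski_inf hA hB

/-- A Zariski motive over `S`: an ambient `S`-scheme together with a Zariski motive on it. -/
structure Motive (S : Scheme.{u}) where
  amb : SSch S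
  sieve : zariskiOn amb

/-- The presheaf on fat points underlying a Zariski motive. -/
def Motive.toPresheaf {S : Scheme.{u}} (M : Motive S) : (FatPt S)ᵒᵖ ⥤ Type u :=
  M.sieve.val.toFunctor

/-- A morphism of motives (a natural transformation `s`) is explicit if it is the restriction of a
morphism of `S`-schemes `φ : V ⟶ Y` on some ambient space `V` of the source: a locally closed
subscheme `i : V ⟶ X` of the given ambient space `X` on which the source is still a sieve. -/
def IsExplicit {S : Scheme.{u}} {M N : Motive S} (s : M.toPresheaf ⟶ N.toPresheaf) : Prop :=
  ∃ (V : SSch S) (i : V ⟶ M.amb) (φ : V ⟶ N.amb), IsImmersion i.hom.left ∧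
    M.sieve.val ≤ im i ∧
    ∀ (T : (FatPt S)ᵒᵖ) (b : (pts V).obj T) (hb : (ptsMap i).app T b ∈ M.sieve.val.obj T),
      Subtype.val (p := (· ∈ N.sieve.val.obj T)) (s.app T ⟨(ptsMap i).app T b, hb⟩) =
        (ptsMap φ).app T b

/-- Two Zariski motives are isomorphic if there are mutually inverse explicit morphisms between
them. -/
def IsoMotive {S : Scheme.{u}} (M N : Motive S) : Prop :=
  ∃ e : M.toPresheaf ≅ N.toPresheaf, IsExplicit e.hom ∧ IsExplicit e.inv

/-- The empty motive on `X`. -/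
def emptyMotive {S : Scheme.{u}} (X : SSch S) : Motive S := ⟨X, ⟨⊥, isZariski_bot X⟩⟩

/-- The motive given by an `S`-scheme `X`, i.e. the whole sieve on `X`. -/
def ofScheme {S : Scheme.{u}} (X : SSch S) : Motive S := ⟨X, ⟨⊤, isZariski_top X⟩⟩

/-- The relations of the Zariski Grothendieck group: the scissor relations for two motives on a
common ambient scheme, the isomorphism relations, and the vanishing of the empty motive. -/
inductive Rel (S : Scheme.{u}) : FreeAbelianGroup (Motive S) → Prop
  | scissor (X : SSch S) (A B : zariskiOn X) :
      Rel S (FreeAbelianGroup.of ⟨X, A⟩ + FreeAbelianGroup.of ⟨X, B⟩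
        - FreeAbelianGroup.of ⟨X, A ⊔ B⟩ - FreeAbelianGroup.of ⟨X, A ⊓ B⟩)
  | iso (M N : Motive S) (h : IsoMotive M N) :
      Rel S (FreeAbelianGroup.of M - FreeAbelianGroup.of N)
  | empty (X : SSch S) : Rel S (FreeAbelianGroup.of (emptyMotive X))

/-- The additive group of the Zariski Grothendieck ring over `S`. -/
abbrev ZarGr (S : Scheme.{u}) :=
  FreeAbelianGroup (Motive S) ⧸ AddSubgroup.closure {r | Rel S r}

/-- The class of a Zariski motive. -/
def motiveClass {S : Scheme.{u}} (M : Motive S) : ZarGr S :=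
  QuotientAddGroup.mk (FreeAbelianGroup.of M)

/-- The class of an `S`-scheme. -/
def schemeClass {S : Scheme.{u}} (X : SSch S) : ZarGr S := motiveClass (ofScheme X)

/-- A point is associated if every element of its local ring is either a unit or a zero-divisor. -/
def IsAssociatedPt (X : Scheme.{u}) (x : X) : Prop :=
  ∀ f : X.presheaf.stalk x, IsUnit f ∨ f ∉ nonZeroDivisors (X.presheaf.stalk x)

/-- `X` is strongly connected if its primary components, that is, the closures of its associated
points, have a common point. -/
def StronglyConnected (X : Scheme.{u}) : Prop :=
  ∃ y : X, ∀ x : X, IsAssociatedPt X x → y ∈ closure {x}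

/-- The strongly connected `S`-schemes. -/
abbrev SCSch (S : Scheme.{u}) := {X : SSch S // StronglyConnected X.obj.left}

/-- Isomorphism over `S` of strongly connected `S`-schemes. -/
def scSetoid (S : Scheme.{u}) : Setoid (SCSch S) where
  r X Y := Nonempty (X.val ≅ Y.val)
  iseqv := ⟨fun X => ⟨Iso.refl X.val⟩, fun ⟨e⟩ => ⟨e.symm⟩, fun ⟨e⟩ ⟨f⟩ => ⟨e ≪≫ f⟩⟩

/-- The isomorphism classes of strongly connected `S`-schemes. -/
abbrev SCClass (S : Scheme.{u}) := Quotient (scSetoid S)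

end Motivic

end

/-! The Zariski motives on a fixed `X` form a distributive lattice generated by the closed
subsieves, which are closed under intersection and, `X` being Noetherian, satisfy the descending
chain condition. In this lattice the strongly connected closed subsieves are sup-prime, and every
other closed subsieve is a finite union of strictly smaller ones. By inclusion-exclusion a valuation
is determined by its values on the strongly connected pieces, and sup-primeness makes these values
freely prescribable (`IsDecomposable.exists_valuation`).

The geometric input is that fat points see the scheme structure. If finitely many closed subschemes
of `Z` contain all fat points, then near any given point one of them contains all infinitesimal
neighbourhoods of a single specialization, and Krull's intersection theorem makes its ideal vanish
near the given point (`exists_ker_ideal_eq_bot`). If that point lies on every primary component, the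
ideal vanishes altogether, because a nonzero ideal would have an associated point generizing it;
this is sup-primeness. Conversely, if the primary components have no common point, their complements
cover `Z`, and the scheme-theoretic closures of finitely many of these complements are proper closed
subschemes containing all fat points (`exists_cover_of_not_stronglyConnected`).

Sending each strongly connected piece to its isomorphism class gives a valuation for each `X`. An
explicit isomorphism carries strongly connected closed pieces to isomorphic ones
(`exists_push_eq_im`), so these valuations respect all relations and descend to coordinates on the
Grothendieck group. The coordinates show independence, and inclusion-exclusion shows generation. -/

namespace Motivic

/-! ### Valuations on distributive lattices -/

/-- A valuation on a lattice with least element, with values in an abelian group. -/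
structure IsValuation {α A : Type*} [Lattice α] [OrderBot α] [AddCommGroup A] (v : α → A) :
    Prop where
  map_bot : v ⊥ = 0
  map_sup_add_inf : ∀ a b, v (a ⊔ b) + v (a ⊓ b) = v a + v b

section Valuation

variable {α A : Type*} [DistribLattice α] [OrderBot α] [AddCommGroup A] {v w : α → A}

lemma IsValuation.sub (hv : IsValuation v) (hw : IsValuation w) :
    IsValuation fun a => v a - w a where
  map_bot := by simp [hv.map_bot, hw.map_bot]
  map_sup_add_inf a b := by
    rw [sub_add_sub_comm, sub_add_sub_comm, hv.map_sup_add_inf, hw.map_sup_add_inf]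

lemma IsValuation.map {B : Type*} [AddCommGroup B] (hv : IsValuation v) (f : A →+ B) :
    IsValuation fun a => f (v a) where
  map_bot := by simp [hv.map_bot]
  map_sup_add_inf a b := by rw [← map_add, hv.map_sup_add_inf, map_add]

/-- Inclusion-exclusion. The meet of `f i` with the join of the rest is the join of the `f i ⊓ f j`,
again a family in `C`; this is why the induction varies `f`. -/
lemma IsValuation.map_finset_sup_mem (hv : IsValuation v) {C : Set α}
    (hC : ∀ a ∈ C, ∀ b ∈ C, a ⊓ b ∈ C) {H : AddSubgroup A} (hH : ∀ a ∈ C, v a ∈ H)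
    {ι : Type*} (s : Finset ι) (f : ι → α) (hf : ∀ i ∈ s, f i ∈ C) : v (s.sup f) ∈ H := by
  classical
  induction s using Finset.induction_on generalizing f with
  | empty => simp [hv.map_bot]
  | insert i s hi ih =>
    have hi' := hf i (Finset.mem_insert_self _ _)
    have hs : ∀ j ∈ s, f j ∈ C := fun j hj => hf j (Finset.mem_insert_of_mem hj)
    have h := hv.map_sup_add_inf (f i) (s.sup f)
    rw [Finset.sup_insert, eq_sub_of_add_eq h, Finset.sup_inf_distrib_left]
    exact H.sub_mem (H.add_mem (hH _ hi') (ih f hs)) (ih _ fun j hj => hC _ hi' _ (hs j hj))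

/-- `C` is a well-founded set closed under intersections, each element of which is in `J` or is a
finite union of smaller elements of `C`. -/
structure IsDecomposable (C J : Set α) : Prop where
  inf_mem : ∀ a ∈ C, ∀ b ∈ C, a ⊓ b ∈ C
  wf : C.WellFoundedOn (· < ·)
  mem_or : ∀ c ∈ C, c ∈ J ∨ ∃ s : Finset α, (∀ a ∈ s, a ∈ C ∧ a < c) ∧ s.sup id = c

variable {C J : Set α}

/-- Inclusion-exclusion also meets intersections of the pieces of `c`, so the inductive step is
given `P` on all smaller elements of `C`, not only on the pieces. -/
lemma IsDecomposable.induction (h : IsDecomposable C J) {P : α → Prop}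
    (hP : ∀ j ∈ J, P j)
    (hs : ∀ (c : α) (s : Finset α), (∀ a ∈ s, a ∈ C ∧ a < c ∧ P a) →
      (∀ a ∈ C, a < c → P a) → s.sup id = c → P c) (c : α) (hc : c ∈ C) : P c := by
  refine h.wf.induction hc fun c hc ih => ?_
  obtain hJ | ⟨s, hsC, hsup⟩ := h.mem_or c hc
  · exact hP c hJ
  · exact hs c s (fun a ha => ⟨(hsC a ha).1, (hsC a ha).2, ih a (hsC a ha).1 (hsC a ha).2⟩)
      ih hsup

lemma IsDecomposable.map_mem (h : IsDecomposable C J) (hv : IsValuation v) {H : AddSubgroup A}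
    (hH : ∀ j ∈ J, v j ∈ H) (c : α) (hc : c ∈ C) : v c ∈ H := by
  refine h.induction hH (fun c s hs hlt hsup => ?_) c hc
  rw [← hsup]
  exact hv.map_finset_sup_mem (C := {a | a ∈ C ∧ a < c})
    (fun a ha b hb => ⟨h.inf_mem a ha.1 b hb.1, inf_le_left.trans_lt ha.2⟩)
    (fun a ha => hlt a ha.1 ha.2) s id (fun a ha => ⟨(hs a ha).1, (hs a ha).2.1⟩)

lemma IsDecomposable.map_finset_sup_mem (h : IsDecomposable C J) (hv : IsValuation v)
    {H : AddSubgroup A} (hH : ∀ j ∈ J, v j ∈ H) (s : Finset α) (hs : ∀ a ∈ s, a ∈ C) :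
    v (s.sup id) ∈ H :=
  hv.map_finset_sup_mem h.inf_mem (h.map_mem hv hH) s id hs

lemma IsDecomposable.eq_of_eqOn (h : IsDecomposable C J) (hv : IsValuation v)
    (hw : IsValuation w) (hJ : ∀ j ∈ J, v j = w j) (s : Finset α) (hs : ∀ a ∈ s, a ∈ C) :
    v (s.sup id) = w (s.sup id) := by
  have := h.map_finset_sup_mem (hv.sub hw) (H := ⊥)
    (fun j hj => by simpa [sub_eq_zero] using hJ j hj) s hs
  simpa [sub_eq_zero] using this

/-- An isomorphism of motives transports only the part of the ambient lattice below its source, so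
decompositions are needed relative to a bound `m`. -/
lemma IsDecomposable.Iic (h : IsDecomposable C J) (m : α) :
    IsDecomposable {c | c ∈ C ∧ c ≤ m} {j | j ∈ J ∧ j ≤ m} where
  inf_mem a ha b hb := ⟨h.inf_mem a ha.1 b hb.1, inf_le_left.trans ha.2⟩
  wf := h.wf.subset fun _ hc => hc.1
  mem_or c hc := by
    obtain hJ | ⟨s, hs, rfl⟩ := h.mem_or c hc.1
    · exact Or.inl ⟨hJ, hc.2⟩
    · exact Or.inr ⟨s, fun a ha => ⟨⟨(hs a ha).1, (hs a ha).2.le.trans hc.2⟩, (hs a ha).2⟩, rfl⟩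

open Classical in
/-- The indicator function of the set of elements of `J` below `a`. -/
noncomputable def lowerIndicator (J : Set α) (a : α) : J → ℤ :=
  fun j => if (j : α) ≤ a then 1 else 0

/-- Sup-primeness turns `j ≤ a ⊔ b` into a disjunction, so that the identity is the one for
indicators of unions and intersections; it also excludes `j = ⊥`. -/
lemma isValuation_lowerIndicator (hJ : ∀ j ∈ J, SupPrime j) :
    IsValuation (lowerIndicator J) where
  map_bot := by
    funext j
    have : (j : α) ≠ ⊥ := (hJ j j.2).ne_bot
    simp [lowerIndicator, this]
  map_sup_add_inf a b := by
    funext j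
    have h : (j : α) ≤ a ⊔ b ↔ (j : α) ≤ a ∨ (j : α) ≤ b := (hJ j j.2).le_sup
    simp only [lowerIndicator, Pi.add_apply, h, le_inf_iff]
    split_ifs <;> simp_all

lemma linearIndependent_lowerIndicator {α : Type*} [DistribLattice α] (J : Set α) :
    LinearIndependent ℤ fun j : J => lowerIndicator J j := by
  rw [linearIndependent_iff]
  intro l hl
  by_contra hne
  -- Triangularity: evaluated at a maximal `j` of the support, every term but that of `j` itself
  -- vanishes.
  obtain ⟨j, hj⟩ := l.support.exists_maximal (Finsupp.support_nonempty_iff.2 hne)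
  have h := congrFun hl j
  rw [Finsupp.linearCombination_apply, Finsupp.sum, Finset.sum_apply,
    Finset.sum_eq_single_of_mem j hj.1] at h
  · simp [lowerIndicator] at h
    exact (Finsupp.mem_support_iff.1 hj.1) h
  · intro k hk hkj
    have : ¬ (j : α) ≤ k := fun hle =>
      hkj (le_antisymm (hj.2 hk hle) hle)
    simp [lowerIndicator, this]

/-- The universal valuation: in a lattice with enough sup-prime elements, there is a valuation
with prescribed (independent) values on these. -/
theorem IsDecomposable.exists_valuation (h : IsDecomposable C J) (hJ : ∀ j ∈ J, SupPrime j)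
    (hgen : ∀ a, ∃ s : Finset α, (∀ c ∈ s, c ∈ C) ∧ s.sup id = a) :
    ∃ e : α → (J →₀ ℤ), IsValuation e ∧ ∀ j : J, e j = Finsupp.single j 1 := by
  have hli := linearIndependent_lowerIndicator J
  have hv := isValuation_lowerIndicator hJ
  -- All values lie in the span of the independent vectors attached to `J`; their coordinates there
  -- are the valuation sought.
  have hmem : ∀ a, lowerIndicator J a ∈
      Submodule.span ℤ (Set.range fun j : J => lowerIndicator J j) := by
    intro a
    obtain ⟨s, hs, rfl⟩ := hgen a
    exact h.map_finset_sup_mem hv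
      (H := (Submodule.span ℤ (Set.range fun j : J => lowerIndicator J j)).toAddSubgroup)
      (fun j hj => Submodule.subset_span ⟨⟨j, hj⟩, rfl⟩) s hs
  refine ⟨fun a => hli.repr ⟨lowerIndicator J a, hmem a⟩, ⟨?_, fun a b => ?_⟩, fun j => ?_⟩
  · rw [← map_zero hli.repr]
    exact congrArg _ (Subtype.ext hv.map_bot)
  · rw [← map_add, ← map_add]
    exact congrArg _ (Subtype.ext (hv.map_sup_add_inf a b))
  · exact hli.repr_eq_single j _ rfl

end Valuation

/-! ### Fat points as infinitesimal neighbourhoods -/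

/-- A morphism of finite type from a one-point affine scheme to a Jacobson scheme is finite. -/
lemma isFinite_of_subsingleton {X Y : Scheme.{u}} (f : X ⟶ Y) [Subsingleton X] [Nonempty X]
    [IsAffine X] [JacobsonSpace Y] [LocallyOfFiniteType f] : IsFinite f := by
  obtain ⟨x⟩ := ‹Nonempty X›
  have hx : IsClosed {x} := 
    Set.eq_univ_of_forall (s := {x}) (fun y => Subsingleton.elim y x) ▸ isClosed_univ
  have := isClosed_singleton_iff_isClosedImmersion.mp hx
  -- The Jacobson hypothesis enters here, for the residue field. Since its spectrum surjects onto
  -- `X`, universal closedness passes to `f`, and a proper quasi-finite morphism is finite.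
  have : IsFinite (X.fromSpecResidueField x ≫ f) :=
    isFinite_iff_locallyOfFiniteType_of_jacobsonSpace.mpr inferInstance
  have : Surjective (X.fromSpecResidueField x) :=
    ⟨fun y => ⟨IsLocalRing.closedPoint _, Subsingleton.elim _ _⟩⟩
  have : UniversallyClosed f := UniversallyClosed.of_comp_surjective (X.fromSpecResidueField x) f
  have : IsProper f := {}
  have : LocallyQuasiFinite f :=
    LocallyQuasiFinite.of_injective (Function.injective_of_subsingleton f)
  exact IsFinite.of_isProper_of_locallyQuasiFinite f

instance {S : Scheme.{u}} (X : SSch S) : X.obj.left.IsSeparated := X.property.1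

instance {S : Scheme.{u}} (X : SSch S) : LocallyOfFiniteType X.obj.hom := X.property.2.1

instance {S : Scheme.{u}} (X : SSch S) : QuasiCompact X.obj.hom := X.property.2.2

lemma isNoetherian_left {S : Scheme.{u}} [IsNoetherian S] (X : SSch S) :
    IsNoetherian X.obj.left where
  toIsLocallyNoetherian := LocallyOfFiniteType.isLocallyNoetherian X.obj.hom
  toCompactSpace := QuasiCompact.compactSpace_of_compactSpace X.obj.hom

section Infinitesimal

variable {X : Scheme.{u}} {U : X.Opens} (hU : IsAffineOpen U) (m : Ideal Γ(X, U))

/-- The infinitesimal neighbourhood `Spec (A / m ^ (n + 1)) ⟶ Spec A ⟶ X` of a point in an affine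
open. -/
noncomputable def infNhd (n : ℕ) : Spec (.of (Γ(X, U) ⧸ m ^ (n + 1))) ⟶ X :=
  Spec.map (CommRingCat.ofHom (Ideal.Quotient.mk (m ^ (n + 1)))) ≫ hU.fromSpec

instance (n : ℕ) : LocallyOfFiniteType (infNhd hU m n) := by
  unfold infNhd
  infer_instance

lemma comap_quotient_pow_eq [hm : m.IsMaximal] (n : ℕ)
    (p : PrimeSpectrum (Γ(X, U) ⧸ m ^ (n + 1))) :
    p.asIdeal.comap (Ideal.Quotient.mk (m ^ (n + 1))) = m := by
  refine (hm.eq_of_le (Ideal.IsPrime.ne_top inferInstance) ?_).symm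
  refine Ideal.IsPrime.le_of_pow_le (n := n + 1) ?_
  conv_lhs => rw [← Ideal.mk_ker (I := m ^ (n + 1))]
  exact Ideal.ker_le_comap _

instance (n : ℕ) [hm : m.IsMaximal] : Subsingleton (Spec (.of (Γ(X, U) ⧸ m ^ (n + 1)))) := by
  refine ⟨fun p q => PrimeSpectrum.ext ?_⟩
  exact Ideal.comap_injective_of_surjective _ Ideal.Quotient.mk_surjective
    ((comap_quotient_pow_eq m n p).trans (comap_quotient_pow_eq m n q).symm)

instance (n : ℕ) [hm : m.IsMaximal] : Nonempty (Spec (.of (Γ(X, U) ⧸ m ^ (n + 1)))) := by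
  have : Nontrivial (Γ(X, U) ⧸ m ^ (n + 1)) := Ideal.Quotient.nontrivial_iff.2 fun h =>
    hm.ne_top (top_le_iff.1 (h.symm.le.trans (Ideal.pow_le_self n.succ_ne_zero)))
  exact inferInstanceAs (Nonempty (PrimeSpectrum (Γ(X, U) ⧸ m ^ (n + 1))))

/-- On `U` the infinitesimal neighbourhood corresponds to the quotient map modulo `m ^ (n + 1)`, and
the ideal of `i` restricts to zero on anything factoring through `i`. -/
lemma ideal_le_of_fac {Y : Scheme.{u}} (i : Y ⟶ X) (n : ℕ)
    (b : Spec (.of (Γ(X, U) ⧸ m ^ (n + 1))) ⟶ Y) (h : b ≫ i = infNhd hU m n) :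
    i.ker.ideal ⟨U, hU⟩ ≤ m ^ (n + 1) := by
  have h1 : i.ker ≤ (infNhd hU m n).ker := h ▸ Scheme.Hom.le_ker_comp b i
  refine (h1 ⟨U, hU⟩).trans ((Scheme.Hom.ideal_ker_le _ _).trans fun a ha => ?_)
  rw [RingHom.mem_ker] at ha
  have hle : (⊤ : (Spec (.of (Γ(X, U) ⧸ m ^ (n + 1)))).Opens) ≤ infNhd hU m n ⁻¹ᵁ U := by
    intro t _
    change hU.fromSpec _ ∈ (U : Set X)
    rw [← hU.range_fromSpec]
    exact ⟨_, rfl⟩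
  have h2 : (infNhd hU m n).appLE U ⊤ hle =
      CommRingCat.ofHom (Ideal.Quotient.mk (m ^ (n + 1))) ≫ (Scheme.ΓSpecIso _).inv := by
    have e : (⊤ : (Spec Γ(X, U)).Opens) ≤ hU.fromSpec ⁻¹ᵁ U := hU.fromSpec_preimage_self.ge
    have h3 : hU.fromSpec.appLE U ⊤ e = (Scheme.ΓSpecIso _).inv := by
      rw [Scheme.Hom.appLE, hU.fromSpec_app_self, Category.assoc, ← Functor.map_comp]
      exact (congrArg _ ((Spec Γ(X, U)).presheaf.map_id _)).trans (Category.comp_id _)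
    unfold infNhd
    rw [← Scheme.Hom.appLE_comp_appLE _ _ U ⊤ ⊤ e le_top, h3, Scheme.ΓSpecIso_inv_naturality]
    simp only [Scheme.Hom.appLE]
    exact congrArg _ ((congrArg _ ((Spec _).presheaf.map_id _)).trans (Category.comp_id _))
  have h4 : (infNhd hU m n).appLE U ⊤ hle a = 0 := by
    simp only [Scheme.Hom.appLE, CommRingCat.comp_apply]
    erw [ha]
    exact map_zero _
  rw [h2] at h4
  have h5 : Ideal.Quotient.mk (m ^ (n + 1)) a = 0 := by
    have := congrArg (Scheme.ΓSpecIso (.of (Γ(X, U) ⧸ m ^ (n + 1)))).hom h4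
    rw [map_zero, CommRingCat.comp_apply, ← CommRingCat.comp_apply _ (Scheme.ΓSpecIso _).hom,
      Iso.inv_hom_id] at this
    exact this
  exact Ideal.Quotient.eq_zero_iff_mem.1 h5

lemma specializes_infNhd [hm : m.IsMaximal] (n : ℕ)
    (p : PrimeSpectrum Γ(X, U)) (hp : p.asIdeal ≤ m) (t) :
    hU.fromSpec p ⤳ infNhd hU m n t := by
  have h : (⟨m, hm.isPrime⟩ : PrimeSpectrum Γ(X, U)) =
      Spec.map (CommRingCat.ofHom (Ideal.Quotient.mk (m ^ (n + 1)))) t :=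
    PrimeSpectrum.ext (comap_quotient_pow_eq m n t).symm
  refine Specializes.map ?_ hU.fromSpec.continuous
  change p ⤳ Spec.map (CommRingCat.ofHom (Ideal.Quotient.mk (m ^ (n + 1)))) t
  rw [← h]
  exact (PrimeSpectrum.le_iff_specializes _ _).1 hp

end Infinitesimal

/-- A consequence of Krull's intersection theorem: an ideal contained in all powers of `m` vanishes
after inverting some element outside of `m`. -/
lemma exists_notMem_mul_eq_zero {A : Type*} [CommRing A] [IsNoetherianRing A] {I m : Ideal A}
    (hm : m.IsPrime) (h : ∀ n : ℕ, I ≤ m ^ (n + 1)) : ∃ f ∉ m, ∀ a ∈ I, f * a = 0 := by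
  classical
  have h1 : ∀ a ∈ I, ∃ f ∉ m, f * a = 0 := by
    intro a ha
    have h2 : a ∈ (⨅ i : ℕ, m ^ i • ⊤ : Submodule A A) := by
      refine Submodule.mem_iInf _ |>.2 fun i => ?_
      rw [smul_eq_mul, Ideal.mul_top]
      exact Ideal.pow_le_pow_right i.le_succ (h i ha)
    -- Krull gives `r ∈ m` with `r * a = a`, so `1 - r` kills `a` and is outside `m`. For the whole
    -- ideal, multiply such elements over a finite set of generators.
    obtain ⟨r, hr⟩ := (m.mem_iInf_smul_pow_eq_bot_iff a).1 h2
    refine ⟨1 - r, fun h3 => hm.ne_top ((Ideal.eq_top_iff_one _).2 ?_), ?_⟩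
    · simpa using m.add_mem h3 r.2
    · rw [sub_mul, one_mul, sub_eq_zero]
      exact hr.symm
  obtain ⟨s, rfl⟩ := IsNoetherian.noetherian I
  choose! f hf hf0 using h1
  refine ⟨∏ a ∈ s, f a, fun h2 => ?_, fun a ha => ?_⟩
  · obtain ⟨a, ha, ha'⟩ := hm.prod_mem_iff.1 h2
    exact hf a (Submodule.subset_span ha) ha'
  · induction ha using Submodule.span_induction with
    | mem a ha =>
      rw [← Finset.prod_erase_mul _ _ ha, mul_assoc, hf0 a (Submodule.subset_span ha), mul_zero]
    | zero => simp
    | add x y _ _ hx hy => rw [mul_add, hx, hy, add_zero]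
    | smul r x _ hx => rw [smul_eq_mul, mul_left_comm, hx, mul_zero]

lemma exists_affine_specialization (X : Scheme.{u}) (y : X) :
    ∃ (U : X.Opens) (hU : IsAffineOpen U) (p : PrimeSpectrum Γ(X, U)) (m : Ideal Γ(X, U)),
      m.IsMaximal ∧ p.asIdeal ≤ m ∧ hU.fromSpec p = y := by
  obtain ⟨U, hU, hy, -⟩ := exists_isAffineOpen_mem_and_subset (TopologicalSpace.Opens.mem_top y)
  have h : y ∈ Set.range hU.fromSpec := by
    rw [hU.range_fromSpec]
    exact hy
  obtain ⟨p, hp⟩ := h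
  obtain ⟨m, hm, hpm⟩ := Ideal.exists_le_maximal _ (PrimeSpectrum.isPrime p).ne_top
  exact ⟨U, hU, p, m, hm, hpm, hp⟩

lemma ideal_basicOpen_eq_bot {X : Scheme.{u}} (I : X.IdealSheafData) (V : X.affineOpens)
    (f : Γ(X, V.1)) (h : ∀ a ∈ I.ideal V, f * a = 0) : I.ideal (X.affineBasicOpen f) = ⊥ := by
  refine (I.map_ideal_basicOpen V f).symm.trans (le_bot_iff.1 (Ideal.map_le_iff_le_comap.2 ?_))
  intro a ha
  have h4 := congrArg (X.presheaf.map (homOfLE (X.basicOpen_le f)).op).hom (h a ha)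
  rw [map_mul, map_zero] at h4
  exact (IsUnit.mul_right_eq_zero (RingedSpace.isUnit_res_basicOpen _ f)).1 h4

section FatPoints

variable {S : Scheme.{u}} [JacobsonSpace S]

/-- The infinitesimal neighbourhoods of a closed point of an `S`-scheme are fat points. -/
noncomputable def infFatPt (Z : SSch S) {U : Z.obj.left.Opens} (hU : IsAffineOpen U)
    (m : Ideal Γ(Z.obj.left, U)) [m.IsMaximal] (n : ℕ) : FatPt S where
  obj := Over.mk (infNhd hU m n ≫ Z.obj.hom)
  property := ⟨isFinite_of_subsingleton (infNhd hU m n ≫ Z.obj.hom),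
    ⟨⟨⟨Classical.arbitrary (Spec (.of (Γ(Z.obj.left, U) ⧸ m ^ (n + 1))))⟩,
      fun _ => Subsingleton.elim (α := Spec (.of (Γ(Z.obj.left, U) ⧸ m ^ (n + 1)))) _ _⟩⟩⟩

/-- The inclusion of an infinitesimal neighbourhood. -/
noncomputable def infFatPtι (Z : SSch S) {U : Z.obj.left.Opens} (hU : IsAffineOpen U)
    (m : Ideal Γ(Z.obj.left, U)) [m.IsMaximal] (n : ℕ) : (infFatPt Z hU m n).obj ⟶ Z.obj :=
  Over.homMk (infNhd hU m n) rfl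

lemma exists_fatPt_specializes (Z : SSch S) (y : Z.obj.left) :
    ∃ (T : FatPt S) (a : T.obj ⟶ Z.obj) (t : T.obj.left), y ⤳ a.left t := by
  obtain ⟨U, hU, p, m, hm, hpm, rfl⟩ := exists_affine_specialization _ y
  exact ⟨infFatPt Z hU m 0, infFatPtι Z hU m 0,
    Classical.arbitrary (Spec (.of (Γ(Z.obj.left, U) ⧸ m ^ (0 + 1)))),
    specializes_infNhd hU m 0 p hpm _⟩

variable [IsNoetherian S]

/-- Each infinitesimal neighbourhood of a specialization of `y` lies in some `Y k`. By pigeonhole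
one `k` serves all orders, and Krull's theorem makes its ideal vanish on a basic open set, which
contains `y` because `y` generizes the chosen point. -/
lemma exists_ker_ideal_eq_bot {Z : SSch S} {ι : Type*} [Finite ι] {Y : ι → SSch S}
    (i : ∀ k, Y k ⟶ Z) (h : ∀ (T : FatPt S) (a : T.obj ⟶ Z.obj), ∃ k, ∃ b : T.obj ⟶ (Y k).obj,
      b ≫ (i k).hom = a) (y : Z.obj.left) :
    ∃ k, ∃ W : Z.obj.left.affineOpens, y ∈ W.1 ∧ (i k).hom.left.ker.ideal W = ⊥ := by
  have := isNoetherian_left Z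
  obtain ⟨U, hU, p, m, hm, hpm, rfl⟩ := exists_affine_specialization _ y
  have h1 : ∀ n, ∃ k, (i k).hom.left.ker.ideal ⟨U, hU⟩ ≤ m ^ (n + 1) := by
    intro n
    obtain ⟨k, b, hb⟩ := h _ (infFatPtι Z hU m n)
    exact ⟨k, ideal_le_of_fac hU m _ n b.left (congrArg (·.left) hb)⟩
  have h2 : ∃ k, ∀ n, (i k).hom.left.ker.ideal ⟨U, hU⟩ ≤ m ^ (n + 1) := by
    by_contra! hcon
    -- If `k` failed at order `f k` for each `k`, then the subscheme that works at an order `N`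
    -- bounding all `f k` would give a contradiction.
    choose f hf using hcon
    obtain ⟨N, hN⟩ := (Set.finite_range f).bddAbove
    obtain ⟨k, hk⟩ := h1 N
    exact hf k (hk.trans (Ideal.pow_le_pow_right (by simpa using hN ⟨k, rfl⟩)))
  obtain ⟨k, hk⟩ := h2
  have : IsNoetherianRing Γ(Z.obj.left, U) :=
    IsLocallyNoetherian.component_noetherian (X := Z.obj.left) ⟨U, hU⟩
  obtain ⟨f, hf, hf0⟩ := exists_notMem_mul_eq_zero hm.isPrime hk
  refine ⟨k, Z.obj.left.affineBasicOpen (U := ⟨U, hU⟩) f, ?_, ?_⟩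
  · have h3 : p ∈ hU.fromSpec ⁻¹ᵁ Z.obj.left.basicOpen f := by
      rw [hU.fromSpec_preimage_basicOpen]
      exact fun h4 => hf (hpm h4)
    exact h3
  · exact ideal_basicOpen_eq_bot _ ⟨U, hU⟩ f hf0

/-- With a single subscheme the local vanishing at every point concerns the same ideal, so it glues
without any connectedness assumption. -/
lemma ker_eq_bot_of_fatPt {E Z : SSch S} (i : E ⟶ Z)
    (h : ∀ (T : FatPt S) (a : T.obj ⟶ Z.obj), ∃ b : T.obj ⟶ E.obj, b ≫ i.hom = a) :
    i.hom.left.ker = ⊥ := by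
  choose k W hW hW0 using exists_ker_ideal_eq_bot (ι := Unit) (fun _ => i)
    fun T a => ⟨(), h T a⟩
  refine Scheme.IdealSheafData.ext_of_iSup_eq_top W ?_ hW0
  exact top_le_iff.1 fun y _ => TopologicalSpace.Opens.mem_iSup.2 ⟨y, hW y⟩

end FatPoints

/-! ### Associated points -/

/-- Associated primes commute with localization, so `P` is associated exactly when the maximal ideal
of `B` is. The latter means that this ideal is the annihilator of one element, which over a
Noetherian ring holds once all nonunits are zero-divisors. -/
lemma forall_isUnit_or_notMem_nonZeroDivisors_iff {A B : Type*} [CommRing A] [CommRing B]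
    [IsNoetherianRing A] [Algebra A B] (P : Ideal A) [P.IsPrime] [IsLocalization.AtPrime B P] :
    (∀ f : B, IsUnit f ∨ f ∉ nonZeroDivisors B) ↔ P ∈ associatedPrimes A A := by
  have : IsNoetherianRing B := IsLocalization.isNoetherianRing P.primeCompl B inferInstance
  have : IsLocalRing B := IsLocalization.AtPrime.isLocalRing B P
  have h := Set.ext_iff.1
    (Module.associatedPrimes.preimage_comap_associatedPrimes_eq_associatedPrimes_of_isLocalizedModule
      P.primeCompl B (Algebra.linearMap A B)) (IsLocalRing.maximalIdeal B)
  have h0 : Ideal.comap (algebraMap A B) (IsLocalRing.maximalIdeal B) = P :=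
    IsLocalization.AtPrime.under_maximalIdeal B P
  rw [Set.mem_preimage, h0] at h
  rw [h]
  constructor
  · intro h1
    have : IsFractionRing B B := IsFractionRing.self_iff_nonZeroDivisors_le_isUnit.2
      fun f hf => (h1 f).resolve_right (not_not.2 hf)
    exact Ideal.IsMaximal.mem_associatedPrimes_of_isFractionRing (A := B) _
  · intro h1 f
    obtain ⟨h2, x, hx⟩ := isAssociatedPrime_iff.1 h1
    refine or_iff_not_imp_left.2 fun hf hf' => h2.ne_top ?_
    have h3 : f ∈ IsLocalRing.maximalIdeal B := hf
    rw [hx, Submodule.mem_colon_singleton, smul_eq_mul, Submodule.mem_bot] at h3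
    rw [hx, (mem_nonZeroDivisors_iff.1 hf').1 x h3]
    exact (Ideal.eq_top_iff_one _).2 (by simp)

lemma isAssociatedPt_fromSpec_iff {X : Scheme.{u}} [IsLocallyNoetherian X] {V : X.Opens}
    (hV : IsAffineOpen V) (p : PrimeSpectrum Γ(X, V)) :
    IsAssociatedPt X (hV.fromSpec p) ↔
      ∃ c : Γ(X, V), ∀ a, a ∈ p.asIdeal ↔ a * c = 0 := by
  have : IsNoetherianRing Γ(X, V) := IsLocallyNoetherian.component_noetherian ⟨V, hV⟩
  have hp : hV.fromSpec p ∈ V := by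
    change hV.fromSpec p ∈ (V : Set X)
    rw [← hV.range_fromSpec]
    exact ⟨p, rfl⟩
  refine (@forall_isUnit_or_notMem_nonZeroDivisors_iff Γ(X, V) (X.presheaf.stalk (hV.fromSpec p))
    _ _ _ (TopCat.Presheaf.algebra_section_stalk X.presheaf (⟨hV.fromSpec p, hp⟩ : V))
    p.asIdeal p.isPrime (hV.isLocalization_stalk' p hp)).trans
    (AssociatedPrimes.mem_iff.trans (isAssociatedPrime_iff.trans ?_))
  refine (and_iff_right p.isPrime).trans (exists_congr fun c => ?_)
  simp [Ideal.ext_iff, Submodule.mem_colon_singleton]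

/-- Take an associated prime `P` of a nonzero module of sections of `I`, the annihilator of some `c`
in it. If `I` vanished near the point of `P`, a power of some `f ∉ P` would kill `c`, forcing `f ∈
P`. -/
lemma exists_isAssociatedPt_of_ne_bot {X : Scheme.{u}} [IsLocallyNoetherian X]
    (I : X.IdealSheafData) (hI : I ≠ ⊥) : ∃ x, IsAssociatedPt X x ∧
      ∀ W : X.affineOpens, x ∈ W.1 → I.ideal W ≠ ⊥ := by
  obtain ⟨V, hV⟩ : ∃ V, I.ideal V ≠ ⊥ := by
    by_contra! h
    exact hI (Scheme.IdealSheafData.ext (funext h))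
  have : IsNoetherianRing Γ(X, V.1) := IsLocallyNoetherian.component_noetherian V
  have : Nontrivial (I.ideal V) := (Submodule.nontrivial_iff_ne_bot).2 hV
  obtain ⟨P, hP⟩ := associatedPrimes.nonempty Γ(X, V.1) (I.ideal V)
  obtain ⟨hP1, c, hc⟩ := isAssociatedPrime_iff.1 hP
  have hc' : ∀ a, a ∈ P ↔ a * (c : Γ(X, V.1)) = 0 := fun a => by
    rw [hc, Submodule.mem_colon_singleton, Submodule.mem_bot, ← Subtype.coe_inj]
    rfl
  refine ⟨V.2.fromSpec ⟨P, hP1⟩, (isAssociatedPt_fromSpec_iff V.2 ⟨P, hP1⟩).2 ⟨c, hc'⟩,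
    fun W hW hW0 => ?_⟩
  have hxV : V.2.fromSpec ⟨P, hP1⟩ ∈ V.1 := by
    change V.2.fromSpec ⟨P, hP1⟩ ∈ (V.1 : Set X)
    rw [← V.2.range_fromSpec]
    exact ⟨⟨P, hP1⟩, rfl⟩
  obtain ⟨f, hfW, hf⟩ := V.2.exists_basicOpen_le ⟨_, hW⟩ hxV
  have h1 : I.ideal (X.affineBasicOpen f) = ⊥ := by
    refine (I.map_ideal (U := X.affineBasicOpen f) (V := W) hfW).symm.trans ?_
    rw [hW0, Ideal.map_bot]
  have h2 : X.presheaf.map (homOfLE (X.basicOpen_le f)).op (c : Γ(X, V.1)) = 0 := by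
    have h3 := Ideal.mem_comap.1 (I.ideal_le_comap_ideal
      (U := X.affineBasicOpen f) (X.basicOpen_le f) c.2)
    rw [h1] at h3
    exact h3
  have := V.2.isLocalization_basicOpen f
  obtain ⟨⟨_, n, rfl⟩, hn⟩ := (IsLocalization.map_eq_zero_iff (.powers f)
    Γ(X, X.basicOpen f) (c : Γ(X, V.1))).1 h2
  have h3 : f ∈ P := hP1.mem_of_pow_mem n ((hc' _).2 hn)
  have h4 : (⟨P, hP1⟩ : PrimeSpectrum Γ(X, V.1)) ∈ V.2.fromSpec ⁻¹ᵁ X.basicOpen f := hf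
  rw [V.2.fromSpec_preimage_basicOpen] at h4
  exact h4 h3

/-- On the complement of the closure of an associated point, some nonzero section vanishes. -/
lemma ker_ι_ne_bot {X : Scheme.{u}} [IsNoetherian X] {x : X} (hx : IsAssociatedPt X x)
    (U : X.Opens) (hU : ∀ q ∈ U, ¬ x ⤳ q) : U.ι.ker ≠ ⊥ := by
  obtain ⟨V, hV, hxV, -⟩ := exists_isAffineOpen_mem_and_subset (TopologicalSpace.Opens.mem_top x)
  have h : x ∈ Set.range hV.fromSpec := by
    rw [hV.range_fromSpec]
    exact hxV
  obtain ⟨p, rfl⟩ := h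
  obtain ⟨c, hc⟩ := (isAssociatedPt_fromSpec_iff hV p).1 hx
  intro h0
  -- The section `c`, with annihilator `p`, has zero germ at each point of `U ⊓ V`: some `g ∈ p` is
  -- a unit there, and `g * c = 0`.
  have h1 : c ∈ U.ι.ker.ideal ⟨V, hV⟩ := by
    rw [Scheme.Hom.ker_apply, RingHom.mem_ker]
    refine TopCat.Presheaf.section_ext X.sheaf (U.ι ''ᵁ U.ι ⁻¹ᵁ V) _ _ fun q hq => ?_
    have hqV : q ∈ V := by
      obtain ⟨q', hq', rfl⟩ := hq
      exact hq'
    have hqU : q ∈ U := by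
      obtain ⟨q', hq', rfl⟩ := hq
      exact q'.2
    have hq' : q ∈ Set.range hV.fromSpec := by
      rw [hV.range_fromSpec]
      exact hqV
    obtain ⟨Q, rfl⟩ := hq'
    have h2 : ¬ p.asIdeal ≤ Q.asIdeal := fun hle => hU _ hqU
      (((PrimeSpectrum.le_iff_specializes _ _).1 hle).map hV.fromSpec.continuous)
    obtain ⟨g, hg, hgQ⟩ := SetLike.not_le_iff_exists.1 h2
    have h3 : hV.fromSpec Q ∈ X.basicOpen g := by
      have : Q ∈ hV.fromSpec ⁻¹ᵁ X.basicOpen g := by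
        rw [hV.fromSpec_preimage_basicOpen]
        exact hgQ
      exact this
    have h4 := (X.mem_basicOpen _ _ hqV).1 h3
    have h5 := congrArg (X.presheaf.germ V _ hqV) ((hc g).1 hg)
    rw [map_mul, map_zero, h4.mul_right_eq_zero] at h5
    refine Eq.trans (Eq.trans ?_ h5) (map_zero _).symm
    exact TopCat.Presheaf.germ_res_apply X.presheaf _ _ _ c
  rw [h0] at h1
  have h2 : c = 0 := h1
  exact p.isPrime.ne_top ((Ideal.eq_top_iff_one _).2 ((hc 1).2 (by rw [h2, mul_zero])))

/-! ### Strong connectedness and covers by closed subschemes -/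

section ClosedSub

variable {S : Scheme.{u}}

/-- The closed subscheme of an `S`-scheme given by an ideal sheaf. -/
noncomputable def closedSub (Z : SSch S) (I : Z.obj.left.IdealSheafData) : SSch S where
  obj := Over.mk (I.subschemeι ≫ Z.obj.hom)
  property := by
    refine ⟨⟨?_⟩, inferInstanceAs (LocallyOfFiniteType (I.subschemeι ≫ Z.obj.hom)),
      inferInstanceAs (QuasiCompact (I.subschemeι ≫ Z.obj.hom))⟩
    change IsSeparated (Limits.terminal.from I.subscheme)
    rw [← Limits.terminal.comp_from I.subschemeι]
    infer_instance

/-- The inclusion of the closed subscheme given by an ideal sheaf. -/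
noncomputable def closedSubι (Z : SSch S) (I : Z.obj.left.IdealSheafData) :
    closedSub Z I ⟶ Z :=
  ⟨Over.homMk I.subschemeι rfl⟩

instance (Z : SSch S) (I : Z.obj.left.IdealSheafData) :
    IsClosedImmersion (closedSubι Z I).hom.left :=
  inferInstanceAs (IsClosedImmersion I.subschemeι)

lemma exists_lift_closedSub {T : Over S} {Z : SSch S} {I : Z.obj.left.IdealSheafData}
    (a : T ⟶ Z.obj) (b : T.left ⟶ I.subscheme) (h : b ≫ I.subschemeι = a.left) :
    ∃ b' : T ⟶ (closedSub Z I).obj, b' ≫ (closedSubι Z I).hom = a := by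
  refine ⟨Over.homMk b ?_, ?_⟩
  · exact (Category.assoc _ _ _).symm.trans
      ((congrArg (· ≫ Z.obj.hom) h).trans (Over.w a))
  · ext1
    exact h

variable [IsNoetherian S]

/-- If the fat points of a strongly connected `S`-scheme are covered by finitely many closed
subschemes, then one of them is everything. -/
lemma StronglyConnected.exists_ker_eq_bot [JacobsonSpace S] {Z : SSch S}
    (hZ : StronglyConnected Z.obj.left) {ι : Type*} [Finite ι] {Y : ι → SSch S} (i : ∀ k, Y k ⟶ Z)
    (h : ∀ (T : FatPt S) (a : T.obj ⟶ Z.obj), ∃ k, ∃ b : T.obj ⟶ (Y k).obj,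
      b ≫ (i k).hom = a) : ∃ k, (i k).hom.left.ker = ⊥ := by
  have := isNoetherian_left Z
  obtain ⟨y, hy⟩ := hZ
  obtain ⟨k, W, hW, hW0⟩ := exists_ker_ideal_eq_bot i h y
  refine ⟨k, by_contra fun hne => ?_⟩
  -- Every associated point `x` specializes to `y`, hence lies in the open set `W` where the ideal
  -- is zero.
  obtain ⟨x, hx, hxW⟩ := exists_isAssociatedPt_of_ne_bot _ hne
  exact hxW W ((specializes_iff_mem_closure.2 (hy x hx)).mem_open W.1.isOpen hW) hW0

/-- Each `y` avoids the closure of some associated point; finitely many complements of such closures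
cover `Z`. Having one point, a fat point lies in one of these open sets, hence in its
scheme-theoretic closure, which is proper by `ker_ι_ne_bot`. -/
lemma exists_cover_of_not_stronglyConnected (Z : SSch S)
    (hZ : ¬ StronglyConnected Z.obj.left) :
    ∃ (t : Finset Z.obj.left) (I : Z.obj.left → Z.obj.left.IdealSheafData), (∀ y, I y ≠ ⊥) ∧
      ∀ (T : FatPt S) (a : T.obj ⟶ Z.obj), ∃ y ∈ t, ∃ b : T.obj ⟶ (closedSub Z (I y)).obj,
        b ≫ (closedSubι Z (I y)).hom = a := by
  have := isNoetherian_left Z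
  unfold StronglyConnected at hZ
  push Not at hZ
  choose x hx hxy using hZ
  let U : Z.obj.left → Z.obj.left.Opens := fun y =>
    ⟨(closure {x y})ᶜ, isClosed_closure.isOpen_compl⟩
  obtain ⟨t, ht⟩ := isCompact_univ.elim_finite_subcover (fun y => (U y : Set Z.obj.left))
    (fun y => (U y).isOpen) fun y _ => Set.mem_iUnion.2 ⟨y, hxy y⟩
  refine ⟨t, fun y => (U y).ι.ker, fun y => ker_ι_ne_bot (hx y) _ fun q hq hsp =>
    hq (specializes_iff_mem_closure.1 hsp), fun T a => ?_⟩
  obtain ⟨hT⟩ := T.property.2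
  obtain ⟨y, hy, hyU⟩ := Set.mem_iUnion₂.1 (ht (Set.mem_univ (a.left hT.default)))
  have hr : Set.range a.left ⊆ Set.range (U y).ι := by
    rw [Scheme.Opens.range_ι]
    rintro _ ⟨s, rfl⟩
    rw [hT.uniq s]
    exact hyU
  refine ⟨y, hy, exists_lift_closedSub a
    (IsOpenImmersion.lift (U y).ι a.left hr ≫ (U y).ι.toImage) ?_⟩
  rw [Category.assoc, Scheme.Hom.toImage_imageι, IsOpenImmersion.lift_fac]

end ClosedSub

/-! ### Factorizations detected on fat points -/

lemma im_le_im_iff {S : Scheme.{u}} {X Y Z : SSch S} {f : Y ⟶ X} {g : Z ⟶ X} :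
    im f ≤ im g ↔ ∀ (T : FatPt S) (a : T.obj ⟶ Y.obj), ∃ b : T.obj ⟶ Z.obj,
      b ≫ g.hom = a ≫ f.hom :=
  ⟨fun h T a => h (op T) ⟨a, rfl⟩, fun h T _ ⟨a, ha⟩ => ha ▸ h T.unop a⟩

lemma im_comp_le {S : Scheme.{u}} {X Y Z : SSch S} (f : Z ⟶ Y) (g : Y ⟶ X) :
    im (f ≫ g) ≤ im g :=
  im_le_im_iff.2 fun _ a => ⟨a ≫ f.hom, Category.assoc _ _ _⟩

/-- Lift of a morphism of schemes between `S`-schemes along a morphism of `S`-schemes. -/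
lemma exists_hom_of_fac {S : Scheme.{u}} {X Y Z : SSch S} (f : Z ⟶ X) (i : Y ⟶ X)
    (g : Z.obj.left ⟶ Y.obj.left) (h : g ≫ i.hom.left = f.hom.left) : ∃ g : Z ⟶ Y, g ≫ i = f := by
  refine ⟨⟨Over.homMk g ?_⟩, ?_⟩
  · rw [← Over.w i.hom, ← Over.w f.hom, ← h, Category.assoc]
  · apply ObjectProperty.hom_ext
    ext1
    exact h

section Fac

variable {S : Scheme.{u}}

lemma ker_closedSubι (Z : SSch S) (I : Z.obj.left.IdealSheafData) :
    (closedSubι Z I).hom.left.ker = I :=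
  I.ker_subschemeι

/-- Reduces questions about lifting `f` through `i` to a closed subscheme of `Z`: the
scheme-theoretic image of the pullback of `i`. -/
lemma exists_lift_ker_pullback_fst {T : Over S} {Z : SSch S} {U V : Scheme.{u}}
    {f : Z.obj.left ⟶ U} {i : V ⟶ U} (a : T ⟶ Z.obj) (b : T.left ⟶ V)
    (h : b ≫ i = a.left ≫ f) :
    ∃ b' : T ⟶ (closedSub Z (Limits.pullback.fst f i).ker).obj,
      b' ≫ (closedSubι Z (Limits.pullback.fst f i).ker).hom = a := by
  refine exists_lift_closedSub a
    (Limits.pullback.lift a.left b h.symm ≫ (Limits.pullback.fst f i).toImage) ?_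
  rw [Category.assoc, Scheme.Hom.toImage_imageι, Limits.pullback.lift_fst]

lemma exists_fac_of_ker_pullback_fst_eq_bot {Z U V : Scheme.{u}} {f : Z ⟶ U} {i : V ⟶ U}
    [IsClosedImmersion i] (h : (Limits.pullback.fst f i).ker = ⊥) : ∃ g : Z ⟶ V, g ≫ i = f := by
  have : IsIso (Limits.pullback.fst f i) := IsClosedImmersion.isIso_iff_ker_eq_bot.2 h
  refine ⟨inv (Limits.pullback.fst f i) ≫ Limits.pullback.snd f i, ?_⟩
  rw [Category.assoc, ← Limits.pullback.condition, IsIso.inv_hom_id_assoc]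

variable [JacobsonSpace S] [IsNoetherian S]

lemma StronglyConnected.exists_fac {Z : SSch S} (hZ : StronglyConnected Z.obj.left)
    {U : Scheme.{u}} (f : Z.obj.left ⟶ U) {ι : Type*} [Finite ι] {V : ι → Scheme.{u}}
    (i : ∀ k, V k ⟶ U) [∀ k, IsClosedImmersion (i k)]
    (h : ∀ (T : FatPt S) (a : T.obj ⟶ Z.obj), ∃ k, ∃ b : T.obj.left ⟶ V k,
      b ≫ i k = a.left ≫ f) : ∃ k, ∃ g : Z.obj.left ⟶ V k, g ≫ i k = f := by
  obtain ⟨k, hk⟩ := hZ.exists_ker_eq_bot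
    (fun k => closedSubι Z (Limits.pullback.fst f (i k)).ker) fun T a => by
      obtain ⟨k, b, hb⟩ := h T a
      exact ⟨k, exists_lift_ker_pullback_fst a b hb⟩
  rw [ker_closedSubι] at hk
  exact ⟨k, exists_fac_of_ker_pullback_fst_eq_bot hk⟩

lemma exists_fac_of_fatPt {Z : SSch S} {U V : Scheme.{u}} (f : Z.obj.left ⟶ U) (i : V ⟶ U)
    [IsClosedImmersion i] (h : ∀ (T : FatPt S) (a : T.obj ⟶ Z.obj), ∃ b : T.obj.left ⟶ V,
      b ≫ i = a.left ≫ f) : ∃ g : Z.obj.left ⟶ V, g ≫ i = f := by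
  have hk := ker_eq_bot_of_fatPt (closedSubι Z (Limits.pullback.fst f i).ker) fun T a => by
      obtain ⟨b, hb⟩ := h T a
      exact exists_lift_ker_pullback_fst a b hb
  rw [ker_closedSubι] at hk
  exact exists_fac_of_ker_pullback_fst_eq_bot hk

/-- Morphisms of `S`-schemes are determined by their values on fat points. -/
lemma hom_ext_of_fatPt {Z Y : SSch S} {f g : Z ⟶ Y}
    (h : ∀ (T : FatPt S) (a : T.obj ⟶ Z.obj), a ≫ f.hom = a ≫ g.hom) : f = g := by
  obtain ⟨s, hs⟩ := exists_fac_of_fatPt (Z := Z) (𝟙 _)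
    (Limits.equalizer.ι f.hom.left g.hom.left) fun T a =>
      ⟨Limits.equalizer.lift a.left (congrArg (·.left) (h T a)), by simp⟩
  apply ObjectProperty.hom_ext
  ext1
  rw [← Category.id_comp f.hom.left, ← Category.id_comp g.hom.left, ← hs, Category.assoc,
    Category.assoc, Limits.equalizer.condition]

/-- If the fat points of `f` lie in a locally closed subscheme, then `f` factors through it. -/
lemma exists_fac_of_im_le {X V Z : SSch S} (f : Z ⟶ X) (i : V ⟶ X) [IsImmersion i.hom.left]
    (h : im f ≤ im i) : ∃ g : Z ⟶ V, g ≫ i = f := by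
  rw [im_le_im_iff] at h
  -- `U` is an open set in which `V` is closed. That `f` lands in `U` can be tested at
  -- specializations coming from fat points, since `U` is stable under generization.
  let U := i.hom.left.coborderRange
  have hr : Set.range f.hom.left ⊆ Set.range U.ι := by
    rw [Scheme.Opens.range_ι]
    rintro _ ⟨y, rfl⟩
    obtain ⟨T, a, t, hyt⟩ := exists_fatPt_specializes Z y
    refine (hyt.map f.hom.left.continuous).mem_open U.isOpen ?_
    obtain ⟨b, hb⟩ := h T a
    have h1 : f.hom.left (a.left t) = i.hom.left (b.left t) :=
      (congrArg (fun q : T.obj ⟶ X.obj => q.left t) hb).symm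
    rw [h1]
    exact subset_coborder ⟨_, rfl⟩
  obtain ⟨g, hg⟩ := exists_fac_of_fatPt (IsOpenImmersion.lift U.ι f.hom.left hr)
    i.hom.left.liftCoborder fun T a => by
      obtain ⟨b, hb⟩ := h T a
      refine ⟨b.left, ?_⟩
      rw [← cancel_mono U.ι, Category.assoc, Category.assoc, IsOpenImmersion.lift_fac,
        Scheme.Hom.liftCoborder_ι]
      exact congrArg (·.left) hb
  refine exists_hom_of_fac f i g ?_
  rw [← i.hom.left.liftCoborder_ι, ← Category.assoc, hg, IsOpenImmersion.lift_fac]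

/-- The two factorizations are mutually inverse because immersions are monomorphisms; thus the sieve
determines the subscheme. -/
lemma nonempty_iso_of_im_eq {X Y Z : SSch S} (i : Y ⟶ X) (j : Z ⟶ X)
    [IsImmersion i.hom.left] [IsImmersion j.hom.left] (h : im i = im j) : Nonempty (Y ≅ Z) := by
  obtain ⟨f, hf⟩ := exists_fac_of_im_le i j h.le
  obtain ⟨g, hg⟩ := exists_fac_of_im_le j i h.ge
  have hm : ∀ {A B : SSch S} (k : A ⟶ B) [IsImmersion k.hom.left] (a b : A ⟶ A),
      a ≫ k = b ≫ k → a = b := fun k _ a b hab => by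
    apply ObjectProperty.hom_ext
    ext1
    rw [← cancel_mono k.hom.left]
    exact congrArg (·.hom.left) hab
  exact ⟨f, g, hm i _ _ (by rw [Category.assoc, hg, hf, Category.id_comp]),
    hm j _ _ (by rw [Category.assoc, hf, hg, Category.id_comp])⟩

end Fac

/-! ### The lattice of Zariski motives and its decomposition -/

/-- An ideal sheaf is determined by its ideals on a finite affine cover, so these embed strictly
monotonically into a finite product of Noetherian ideal lattices. -/
instance (X : Scheme.{u}) [IsNoetherian X] : WellFoundedGT X.IdealSheafData := by
  choose U hU hxU _ using fun x : X =>
    exists_isAffineOpen_mem_and_subset (TopologicalSpace.Opens.mem_top x)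
  obtain ⟨t, ht⟩ := isCompact_univ.elim_finite_subcover (fun x => (U x : Set X))
    (fun x => (U x).isOpen) fun y _ => Set.mem_iUnion.2 ⟨y, hxU y⟩
  have htop : ⨆ x : t, U x = ⊤ := top_le_iff.1 fun y _ => by
    obtain ⟨x, hx, hyx⟩ := Set.mem_iUnion₂.1 (ht (Set.mem_univ y))
    exact TopologicalSpace.Opens.mem_iSup.2 ⟨⟨x, hx⟩, hyx⟩
  have hmono : StrictMono fun (I : X.IdealSheafData) (x : t) => I.ideal ⟨U x, hU x⟩ := by
    refine Monotone.strictMono_of_injective (fun I J h x => h _) fun I J h => ?_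
    exact Scheme.IdealSheafData.ext_of_iSup_eq_top (fun x : t => ⟨U x, hU x⟩) htop
      fun x => congrFun h x
  have (x : t) : IsNoetherianRing Γ(X, U x) :=
    IsLocallyNoetherian.component_noetherian ⟨U x, hU x⟩
  have h : WellFoundedLT (∀ x : t, (Ideal Γ(X, U x))ᵒᵈ) := inferInstance
  have : WellFoundedGT (∀ x : t, Ideal Γ(X, U x)) := ⟨h.wf⟩
  exact hmono.wellFoundedGT

section Lattice

variable {S : Scheme.{u}} (X : SSch S)

instance : DistribLattice (zariskiOn X) :=
  DistribLattice.ofInfSupLe fun _ _ _ _ _ h =>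
    h.2.elim (fun h2 => Or.inl ⟨h.1, h2⟩) fun h2 => Or.inr ⟨h.1, h2⟩

instance : OrderBot (zariskiOn X) where
  bot := ⟨⊥, isZariski_bot X⟩
  bot_le _ := bot_le (α := SieveOn X)

variable {X}

lemma mem_finset_sup {ι : Type*} (s : Finset ι) (f : ι → zariskiOn X) (T : (FatPt S)ᵒᵖ)
    (a : (pts X).obj T) : a ∈ (s.sup f).val.obj T ↔ ∃ k ∈ s, a ∈ (f k).val.obj T := by
  classical
  induction s using Finset.induction_on with
  | empty =>
    simp only [Finset.sup_empty, Finset.notMem_empty, false_and, exists_false, iff_false]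
    exact fun h => h
  | insert k s hk ih =>
    rw [Finset.sup_insert, Finset.exists_mem_insert, ← ih]
    rfl

/-- The closed subsieves on `X`. -/
def closedSieves (X : SSch S) : Set (zariskiOn X) :=
  {A | ∃ (Y : SSch S) (i : Y ⟶ X), IsClosedImmersion i.hom.left ∧ A.val = im i}

/-- The closed subsieves given by strongly connected closed subschemes. -/
def scSieves (X : SSch S) : Set (zariskiOn X) :=
  {A | ∃ (Y : SSch S) (i : Y ⟶ X), StronglyConnected Y.obj.left ∧
    IsClosedImmersion i.hom.left ∧ A.val = im i}

lemma isZariski_im {Y : SSch S} (i : Y ⟶ X) (hi : IsClosedImmersion i.hom.left) :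
    IsZariski (im i) :=
  ⟨PUnit, inferInstance, fun _ => Y, fun _ => i, fun _ => hi, iSup_const.symm⟩

lemma exists_finset_sup_eq (A : zariskiOn X) :
    ∃ s : Finset (zariskiOn X), (∀ c ∈ s, c ∈ closedSieves X) ∧ s.sup id = A := by
  classical
  obtain ⟨A, ι, _, Y, i, hi, rfl⟩ := A
  have := Fintype.ofFinite ι
  refine ⟨Finset.univ.image fun k => ⟨im (i k), isZariski_im (i k) (hi k)⟩, ?_, ?_⟩
  · intro c hc
    obtain ⟨k, -, rfl⟩ := Finset.mem_image.1 hc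
    exact ⟨Y k, i k, hi k, rfl⟩
  · rw [Finset.sup_image]
    ext T a
    rw [mem_finset_sup]
    simp

end Lattice

section Decomposition

variable {S : Scheme.{u}} [JacobsonSpace S] [IsNoetherian S]

lemma StronglyConnected.exists_fac_of_le_sup {X Z : SSch S} (hZ : StronglyConnected Z.obj.left)
    (f : Z ⟶ X) {A B : SieveOn X} (hA : IsZariski A) (hB : IsZariski B) (h : im f ≤ A ⊔ B) :
    ∃ (Y : SSch S) (j : Y ⟶ X), IsClosedImmersion j.hom.left ∧ (im j ≤ A ∨ im j ≤ B) ∧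
      ∃ g : Z ⟶ Y, g ≫ j = f := by
  obtain ⟨ι, _, Y, i, hi, rfl⟩ := hA
  obtain ⟨κ, _, W, j, hj, rfl⟩ := hB
  have (k : ι ⊕ κ) : IsClosedImmersion (Sum.rec (motive := fun k =>
      (Sum.elim Y W k).obj.left ⟶ X.obj.left) (fun k => (i k).hom.left) (fun k => (j k).hom.left)
      k) := by
    cases k
    exacts [hi _, hj _]
  obtain ⟨k, g, hg⟩ := hZ.exists_fac f.hom.left (ι := ι ⊕ κ)
    (V := fun k => (Sum.elim Y W k).obj.left)
    (fun k => Sum.rec (fun k => (i k).hom.left) (fun k => (j k).hom.left) k) fun T a => by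
      have h1 := h (op T) ⟨a, rfl⟩
      rw [Subfunctor.max_obj, Subfunctor.iSup_obj, Subfunctor.iSup_obj] at h1
      obtain h1 | h1 := h1
      · obtain ⟨k, b, hb⟩ := Set.mem_iUnion.1 h1
        change T.obj ⟶ (Y k).obj at b
        exact ⟨Sum.inl k, b.left,
          congrArg (fun q : T.obj ⟶ X.obj => q.left) hb⟩
      · obtain ⟨k, b, hb⟩ := Set.mem_iUnion.1 h1
        change T.obj ⟶ (W k).obj at b
        exact ⟨Sum.inr k, b.left,
          congrArg (fun q : T.obj ⟶ X.obj => q.left) hb⟩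
  cases k with
  | inl k => exact ⟨Y k, i k, hi k, Or.inl (le_iSup (fun k => im (i k)) k),
      exists_hom_of_fac f (i k) g hg⟩
  | inr k => exact ⟨W k, j k, hj k, Or.inr (le_iSup (fun k => im (j k)) k),
      exists_hom_of_fac f (j k) g hg⟩

lemma supPrime_of_mem_scSieves {X : SSch S} {A : zariskiOn X} (hA : A ∈ scSieves X) :
    SupPrime A := by
  obtain ⟨Z, i, hZ, hi, hA⟩ := hA
  refine ⟨fun hmin => ?_, fun {B C} hBC => ?_⟩
  · obtain ⟨y, -⟩ := hZ
    obtain ⟨T, a, -⟩ := exists_fatPt_specializes Z y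
    have h : im i ≤ ⊥ := hA ▸ hmin (bot_le (a := A))
    exact h (op T) ⟨a, rfl⟩
  · obtain ⟨Y, j, -, hj, g, rfl⟩ := hZ.exists_fac_of_le_sup i B.2 C.2 (hA ▸ hBC)
    refine hj.imp (fun h => ?_) fun h => ?_
    · exact (hA.le.trans (im_comp_le g j)).trans h
    · exact (hA.le.trans (im_comp_le g j)).trans h

/-- Strict inclusion of closed subsieves reverses to strict inclusion of ideal sheaves, where the
ascending chain condition holds. -/
lemma wellFoundedOn_closedSieves (X : SSch S) : (closedSieves X).WellFoundedOn (· < ·) := by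
  have := isNoetherian_left X
  choose Y i hi hA using fun A : closedSieves X => A.2
  have hlt : Subrelation (fun A B : closedSieves X => (A : zariskiOn X) < B)
      (InvImage (· > ·) fun A => (i A).hom.left.ker) := by
    intro A B hAB
    have hle : im (i A) ≤ im (i B) := hA A ▸ hA B ▸ hAB.le
    have := hi A
    have := hi B
    obtain ⟨g, hg⟩ := exists_fac_of_im_le (i A) (i B) hle
    have hg' : g.hom.left ≫ (i B).hom.left = (i A).hom.left := congrArg (·.hom.left) hg
    have hker : (i B).hom.left.ker ≤ (i A).hom.left.ker :=
      hg' ▸ Scheme.Hom.le_ker_comp g.hom.left (i B).hom.left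
    refine lt_of_le_not_ge hker fun hker => ?_
    obtain ⟨g', hg'⟩ := exists_hom_of_fac (i B) (i A)
      (IsClosedImmersion.lift (i A).hom.left (i B).hom.left hker) (IsClosedImmersion.lift_fac _ _ _)
    have hle' : im (i B) ≤ im (i A) := hg' ▸ im_comp_le g' (i A)
    refine hAB.not_ge ?_
    change (B : zariskiOn X).val ≤ (A : zariskiOn X).val
    rwa [hA A, hA B]
  exact Subrelation.wf hlt (InvImage.wf _ wellFounded_gt)

lemma isDecomposable_closedSieves (X : SSch S) :
    IsDecomposable (closedSieves X) (scSieves X) where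
  inf_mem := by
    rintro A ⟨Y, i, hi, hA⟩ B ⟨Z, j, hj, hB⟩
    obtain ⟨W, l, hl, h⟩ := exists_im_inf i j hi hj
    exact ⟨W, l, hl, h ▸ hA ▸ hB ▸ rfl⟩
  wf := wellFoundedOn_closedSieves X
  mem_or := by
    classical
    rintro A ⟨Z, i, hi, hA⟩
    by_cases hZ : StronglyConnected Z.obj.left
    · exact Or.inl ⟨Z, i, hZ, hi, hA⟩
    obtain ⟨t, I, hI, ht⟩ := exists_cover_of_not_stronglyConnected Z hZ
    have hc (y) : IsClosedImmersion (closedSubι Z (I y) ≫ i).hom.left :=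
      inferInstanceAs (IsClosedImmersion ((closedSubι Z (I y)).hom.left ≫ i.hom.left))
    refine Or.inr ⟨t.image fun y => ⟨im (closedSubι Z (I y) ≫ i), isZariski_im _ (hc y)⟩, ?_, ?_⟩
    · intro B hB
      obtain ⟨y, -, rfl⟩ := Finset.mem_image.1 hB
      refine ⟨⟨_, _, hc y, rfl⟩, lt_of_le_not_ge ?_ fun hle => ?_⟩
      · exact (im_comp_le _ i).trans hA.ge
      · have hle' : im i ≤ im (closedSubι Z (I y) ≫ i) := hA ▸ hle
        rw [im_le_im_iff] at hle'
        -- Were the piece not strictly smaller, all fat points of `Z` would lift to it and its ideal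
        -- `I y` would be zero.
        refine hI y ?_
        rw [← ker_closedSubι Z (I y)]
        refine ker_eq_bot_of_fatPt _ fun T a => ?_
        obtain ⟨b, hb⟩ := hle' T a
        refine ⟨b, ?_⟩
        ext1
        rw [← cancel_mono i.hom.left]
        refine Eq.trans ?_ (congrArg (·.left) hb)
        exact Category.assoc _ _ _
    · rw [Finset.sup_image]
      ext T a
      rw [mem_finset_sup, hA]
      constructor
      · rintro ⟨y, -, h⟩
        exact im_comp_le _ i T h
      · rintro ⟨a, rfl⟩
        change T.unop.obj ⟶ Z.obj at a
        obtain ⟨y, hy, b, hb⟩ := ht T.unop a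
        refine ⟨y, hy, b, ?_⟩
        subst hb
        exact (Category.assoc b (closedSubι Z (I y)).hom i.hom).symm

/-- There is a valuation on Zariski motives sending a strongly connected closed subscheme to its
isomorphism class. -/
lemma exists_classValuation (X : SSch S) : ∃ e : zariskiOn X → SCClass S →₀ ℤ, IsValuation e ∧
    ∀ (Z : SCSch S) (i : Z.val ⟶ X) (A : zariskiOn X), IsClosedImmersion i.hom.left →
      A.val = im i → e A = Finsupp.single (Quotient.mk (scSetoid S) Z) 1 := by
  obtain ⟨e, he, heJ⟩ := (isDecomposable_closedSieves X).exists_valuation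
    (fun _ => supPrime_of_mem_scSieves) exists_finset_sup_eq
  choose Y j hY hj hA using fun A : scSieves X => A.2
  refine ⟨_, he.map (Finsupp.mapDomain.addMonoidHom fun A =>
    Quotient.mk (scSetoid S) ⟨Y A, hY A⟩), fun Z i A hi hAi => ?_⟩
  have hAJ : A ∈ scSieves X := ⟨Z.val, i, Z.2, hi, hAi⟩
  have := hj ⟨A, hAJ⟩
  have h : Quotient.mk (scSetoid S) ⟨Y ⟨A, hAJ⟩, hY ⟨A, hAJ⟩⟩ = Quotient.mk (scSetoid S) Z :=
    Quotient.sound (nonempty_iso_of_im_eq (j ⟨A, hAJ⟩) i ((hA ⟨A, hAJ⟩).symm.trans hAi))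
  rw [heJ ⟨A, hAJ⟩, Finsupp.mapDomain.addMonoidHom_apply, Finsupp.mapDomain_single, h]

/-- The valuation on Zariski motives on `X` sending a strongly connected closed subscheme to its
isomorphism class. -/
noncomputable def classValuation (X : SSch S) : zariskiOn X → SCClass S →₀ ℤ :=
  (exists_classValuation X).choose

lemma isValuation_classValuation (X : SSch S) : IsValuation (classValuation X) :=
  (exists_classValuation X).choose_spec.1

lemma classValuation_eq_single {X : SSch S} (Z : SCSch S) (i : Z.val ⟶ X) (A : zariskiOn X)
    (hi : IsClosedImmersion i.hom.left) (hA : A.val = im i) :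
    classValuation X A = Finsupp.single (Quotient.mk (scSetoid S) Z) 1 :=
  (exists_classValuation X).choose_spec.2 Z i A hi hA

end Decomposition

/-! ### Invariance under explicit isomorphisms -/

section Push

variable {S : Scheme.{u}} {M N : Motive S}

/-- The image of a sieve under a morphism of motives. -/
def push (s : M.toPresheaf ⟶ N.toPresheaf) (A : SieveOn M.amb) : SieveOn N.amb where
  obj T := {b | ∃ a : M.toPresheaf.obj T, a.1 ∈ A.obj T ∧ (s.app T a).1 = b}
  map {T T'} f := by
    rintro _ ⟨a, ha, rfl⟩
    refine ⟨M.toPresheaf.map f a, A.map f ha, ?_⟩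
    exact congrArg Subtype.val (NatTrans.naturality_apply s f a)

variable (s : M.toPresheaf ⟶ N.toPresheaf) (A B : SieveOn M.amb)

lemma push_bot : push s ⊥ = ⊥ :=
  le_bot_iff.1 fun _ _ ⟨_, ha, _⟩ => ha

lemma push_sup : push s (A ⊔ B) = push s A ⊔ push s B := by
  ext T b
  constructor
  · rintro ⟨a, ha | ha, h⟩
    exacts [Or.inl ⟨a, ha, h⟩, Or.inr ⟨a, ha, h⟩]
  · rintro (⟨a, ha, h⟩ | ⟨a, ha, h⟩)
    exacts [⟨a, Or.inl ha, h⟩, ⟨a, Or.inr ha, h⟩]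

lemma push_inf_self : push s (A ⊓ M.sieve.val) = push s A := by
  ext T b
  exact ⟨fun ⟨a, ha, h⟩ => ⟨a, ha.1, h⟩, fun ⟨a, ha, h⟩ => ⟨a, ⟨ha, a.2⟩, h⟩⟩

variable (e : M.toPresheaf ≅ N.toPresheaf)

lemma push_inf : push e.hom (A ⊓ B) = push e.hom A ⊓ push e.hom B := by
  ext T b
  constructor
  · rintro ⟨a, ⟨ha, hb⟩, h⟩
    exact ⟨⟨a, ha, h⟩, ⟨a, hb, h⟩⟩
  · rintro ⟨⟨a, ha, rfl⟩, ⟨a', ha', h⟩⟩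
    have : a' = a := by
      have := congrArg (e.inv.app T) (Subtype.ext h : e.hom.app T a' = e.hom.app T a)
      simpa using this
    subst this
    exact ⟨a', ⟨ha, ha'⟩, rfl⟩

lemma push_top : push e.hom M.sieve.val = N.sieve.val := by
  ext T b
  constructor
  · rintro ⟨a, -, rfl⟩
    exact (e.hom.app T a).2
  · intro hb
    refine ⟨e.inv.app T ⟨b, hb⟩, (e.inv.app T ⟨b, hb⟩).2, ?_⟩
    exact congrArg Subtype.val
      (ConcreteCategory.congr_hom (e.inv_hom_id_app T) (⟨b, hb⟩ : N.toPresheaf.obj T))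

end Push

lemma explicit_apply {S : Scheme.{u}} {M N : Motive S} {s : M.toPresheaf ⟶ N.toPresheaf}
    {V : SSch S} {i : V ⟶ M.amb} {φ : V ⟶ N.amb}
    (h : ∀ (T : (FatPt S)ᵒᵖ) (b : (pts V).obj T) (hb : (ptsMap i).app T b ∈ M.sieve.val.obj T),
      Subtype.val (p := (· ∈ N.sieve.val.obj T)) (s.app T ⟨(ptsMap i).app T b, hb⟩) =
        (ptsMap φ).app T b) (T : FatPt S) (b : T.obj ⟶ V.obj) (a : T.obj ⟶ M.amb.obj)
    (ha : a ∈ M.sieve.val.obj (op T)) (hab : b ≫ i.hom = a) :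
    (s.app (op T) ⟨a, ha⟩).1 = b ≫ φ.hom := by
  subst hab
  exact h (op T) b ha

section Invariance

variable {S : Scheme.{u}} [JacobsonSpace S] [IsNoetherian S] {M N : Motive S}

/-- An explicit isomorphism maps strongly connected closed subsieves to such. -/
lemma exists_push_eq_im {e : M.toPresheaf ≅ N.toPresheaf} (h1 : IsExplicit e.hom)
    (h2 : IsExplicit e.inv) {Z : SSch S} (hZ : StronglyConnected Z.obj.left) (i : Z ⟶ M.amb)
    (hi : IsClosedImmersion i.hom.left) (hiM : im i ≤ M.sieve.val) :
    ∃ j : Z ⟶ N.amb, IsClosedImmersion j.hom.left ∧ push e.hom (im i) = im j := by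
  obtain ⟨V, iV, φ, hV, hMV, hφ⟩ := h1
  obtain ⟨W, iW, ψ, hW, hNW, hψ⟩ := h2
  obtain ⟨g, rfl⟩ := exists_fac_of_im_le i iV (hiM.trans hMV)
  have key (T : FatPt S) (t : T.obj ⟶ Z.obj) : ∃ hm : t ≫ (g ≫ iV).hom ∈ M.sieve.val.obj (op T),
      (e.hom.app (op T) ⟨t ≫ (g ≫ iV).hom, hm⟩).1 = t ≫ (g ≫ φ).hom := by
    refine ⟨hiM (op T) ⟨t, rfl⟩, ?_⟩
    exact (explicit_apply hφ T (t ≫ g.hom) _ _ (Category.assoc _ _ _)).trans (Category.assoc _ _ _)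
  have hpush : push e.hom (im (g ≫ iV)) = im (g ≫ φ) := by
    ext T b
    constructor
    · rintro ⟨⟨_, ha⟩, ⟨t, rfl⟩, rfl⟩
      exact ⟨t, (key T.unop t).2.symm⟩
    · rintro ⟨t, rfl⟩
      exact ⟨⟨_, (key T.unop t).1⟩, ⟨t, rfl⟩, (key T.unop t).2⟩
  refine ⟨g ≫ φ, ?_, hpush⟩
  -- So far `g ≫ φ` need not be closed. As `Z` is strongly connected, it factors as `h ≫ j` through
  -- one closed subscheme contained in the target motive; `N` is doubled only to fit the binary form
  -- of the lemma.
  have hN : im (g ≫ φ) ≤ N.sieve.val ⊔ N.sieve.val := by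
    rw [sup_idem, ← hpush, ← push_top e]
    rintro T _ ⟨a, ha, rfl⟩
    exact ⟨a, hiM T ha, rfl⟩
  obtain ⟨Y, j, hj, hjN, h, hh⟩ := hZ.exists_fac_of_le_sup (g ≫ φ) N.sieve.2 N.sieve.2 hN
  rw [or_self] at hjN
  obtain ⟨g', rfl⟩ := exists_fac_of_im_le j iW (hjN.trans hNW)
  -- The inverse returns each fat point, so `h` followed by another morphism is the given closed
  -- immersion. Hence `h` is a closed immersion, and so is its composite with `j`.
  have hid : h ≫ g' ≫ ψ = g ≫ iV := by
    refine hom_ext_of_fatPt fun T t => ?_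
    obtain ⟨hm, ht⟩ := key T t
    have h3 : t ≫ (g ≫ φ).hom ∈ N.sieve.val.obj (op T) := ht ▸ (e.hom.app (op T) _).2
    have h4 := explicit_apply hψ T (t ≫ (h ≫ g').hom) _ h3 (by
      rw [← hh]
      exact (Category.assoc _ _ _).trans
        (congrArg (t ≫ ·) (Category.assoc h.hom g'.hom iW.hom)))
    have h5 : e.hom.app (op T) ⟨t ≫ (g ≫ iV).hom, hm⟩ = ⟨t ≫ (g ≫ φ).hom, h3⟩ := Subtype.ext ht
    rw [← h5] at h4
    have h6 : e.inv.app (op T) (e.hom.app (op T) ⟨t ≫ (g ≫ iV).hom, hm⟩) = ⟨_, hm⟩ :=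
      ConcreteCategory.congr_hom (e.hom_inv_id_app (op T))
        (⟨t ≫ (g ≫ iV).hom, hm⟩ : M.toPresheaf.obj (op T))
    rw [h6] at h4
    refine Eq.trans ?_ h4.symm
    exact (congrArg (t ≫ ·) (Category.assoc h.hom g'.hom ψ.hom).symm).trans
      (Category.assoc _ _ _).symm
  have h3 : IsClosedImmersion (h.hom.left ≫ (g' ≫ ψ).hom.left) :=
    (congrArg (·.hom.left) hid : h.hom.left ≫ (g' ≫ ψ).hom.left = _) ▸ hi
  have h4 : IsClosedImmersion h.hom.left := IsClosedImmersion.of_comp _ (g' ≫ ψ).hom.left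
  rw [← hh]
  exact inferInstanceAs (IsClosedImmersion (h.hom.left ≫ (g' ≫ iW).hom.left))

/-- The strongly connected pieces have closed images by `exists_push_eq_im`, and images commute with
finite unions. -/
lemma isZariski_push {e : M.toPresheaf ≅ N.toPresheaf} (h1 : IsExplicit e.hom)
    (h2 : IsExplicit e.inv) (A : zariskiOn M.amb) : IsZariski (push e.hom A.val) := by
  classical
  have hsup (s : Finset (zariskiOn M.amb)) (hs : ∀ a ∈ s, IsZariski (push e.hom a.val)) :
      IsZariski (push e.hom (s.sup id).val) := by
    induction s using Finset.induction_on with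
    | empty => exact (push_bot e.hom).symm ▸ isZariski_bot _
    | insert a s _ ih =>
      rw [Finset.sup_insert]
      refine (push_sup e.hom _ _).symm ▸ isZariski_sup (hs a (Finset.mem_insert_self _ _))
        (ih fun b hb => hs b (Finset.mem_insert_of_mem hb))
  have hC := ((isDecomposable_closedSieves M.amb).Iic M.sieve).induction
    (P := fun A => IsZariski (push e.hom A.val))
    (fun A ⟨⟨Z, i, hZ, hi, hA⟩, hAM⟩ => by
      obtain ⟨j, hj, hij⟩ := exists_push_eq_im h1 h2 hZ i hi (hA ▸ hAM)
      rw [hA, hij]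
      exact isZariski_im j hj)
    (fun c s hs _ hc => hc ▸ hsup s fun a ha => (hs a ha).2.2)
  obtain ⟨s, hs, hsA⟩ := exists_finset_sup_eq (A ⊓ M.sieve)
  have hA : push e.hom A.val = push e.hom (s.sup id).val := by
    rw [hsA]
    exact (push_inf_self e.hom A.val).symm
  rw [hA]
  exact hsup s fun a ha => hC a ⟨hs a ha, (Finset.le_sup (f := id) ha).trans
    (hsA.le.trans inf_le_right)⟩

/-- The class valuation of the source and that of the target pulled back along `push` agree on
strongly connected closed pieces below `M`, hence on `M` itself. -/
lemma classValuation_eq_of_isoMotive (h : IsoMotive M N) :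
    classValuation M.amb M.sieve = classValuation N.amb N.sieve := by
  obtain ⟨e, h1, h2⟩ := h
  have hv : IsValuation fun A => classValuation M.amb (A ⊓ M.sieve) :=
    ⟨by rw [bot_inf_eq]; exact (isValuation_classValuation M.amb).map_bot, fun A B => by
      rw [inf_sup_right, inf_inf_distrib_right]
      exact (isValuation_classValuation M.amb).map_sup_add_inf _ _⟩
  have hw : IsValuation fun A : zariskiOn M.amb =>
      classValuation N.amb ⟨push e.hom A.val, isZariski_push h1 h2 A⟩ := by
    refine ⟨?_, fun A B => ?_⟩
    · rw [← (isValuation_classValuation N.amb).map_bot]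
      exact congrArg _ (Subtype.ext (push_bot e.hom))
    · refine Eq.trans ?_ ((isValuation_classValuation N.amb).map_sup_add_inf _ _)
      exact congrArg₂ _ (congrArg _ (Subtype.ext (push_sup e.hom A.val B.val)))
        (congrArg _ (Subtype.ext (push_inf A.val B.val e)))
  obtain ⟨s, hs, hsM⟩ := exists_finset_sup_eq M.sieve
  have hfin := ((isDecomposable_closedSieves M.amb).Iic M.sieve).eq_of_eqOn hv hw
    (fun A ⟨⟨Z, i, hZ, hi, hA⟩, hAM⟩ => by
      obtain ⟨j, hj, hij⟩ := exists_push_eq_im h1 h2 hZ i hi (hA ▸ hAM)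
      rw [inf_eq_left.2 hAM, classValuation_eq_single ⟨Z, hZ⟩ i A hi hA]
      exact (classValuation_eq_single ⟨Z, hZ⟩ j _ hj
        ((congrArg (push e.hom) hA).trans hij)).symm) s
    fun a ha => ⟨hs a ha, (Finset.le_sup (f := id) ha).trans hsM.le⟩
  rw [hsM, inf_idem] at hfin
  exact hfin.trans (congrArg _ (Subtype.ext (push_top e)))

end Invariance

/-! ### Classes in the Grothendieck group -/

section ClosedMotive

variable {S : Scheme.{u}}

lemma comp_hom_injective {X Z : SSch S} (i : Z ⟶ X) [Mono i.hom.left] {T : Over S}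
    (t t' : T ⟶ Z.obj) (h : t ≫ i.hom = t' ≫ i.hom) : t = t' := by
  ext1
  rw [← cancel_mono i.hom.left]
  exact congrArg (·.left) h

/-- An immersion `i : Z ⟶ X` induces a bijection from `Z°` to its image sieve. -/
noncomputable def ofSchemeIso {X Z : SSch S} (i : Z ⟶ X) [Mono i.hom.left] (A : zariskiOn X)
    (hA : A.val = im i) :
    (ofScheme Z).toPresheaf ≅ (⟨X, A⟩ : Motive S).toPresheaf :=
  NatIso.ofComponents (fun T => (Equiv.ofBijective
    (fun t : (ofScheme Z).toPresheaf.obj T =>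
      (⟨(ptsMap i).app T t.1, hA.symm ▸ ⟨t.1, rfl⟩⟩ : (⟨X, A⟩ : Motive S).toPresheaf.obj T))
    ⟨fun t t' h => Subtype.ext
      (comp_hom_injective (T := T.unop.obj) i _ _ (congrArg Subtype.val h)), fun ⟨a, ha⟩ => by
      have ha' : a ∈ (im i).obj T := hA ▸ ha
      obtain ⟨t, rfl⟩ := ha'
      exact ⟨⟨t, trivial⟩, rfl⟩⟩).toIso) fun {T T'} f => by
    ext t
    refine Subtype.ext ?_
    exact (NatTrans.naturality_apply (ptsMap i) f t.1)

/-- Explicitness of the inverse uses the freedom to shrink the ambient space: on `Z`, immersed in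
`X` by `i`, the inverse is given by the identity. -/
lemma isoMotive_ofScheme {X Z : SSch S} (i : Z ⟶ X) [IsClosedImmersion i.hom.left]
    (A : zariskiOn X) (hA : A.val = im i) : IsoMotive (ofScheme Z) ⟨X, A⟩ := by
  refine ⟨ofSchemeIso i A hA, ⟨Z, 𝟙 Z, i, inferInstanceAs (IsImmersion (𝟙 Z.obj.left)), ?_, ?_⟩,
    ⟨Z, i, 𝟙 Z, inferInstance, hA.le, ?_⟩⟩
  · rintro T a -
    exact ⟨a, Category.comp_id (X := T.unop.obj) (Y := Z.obj) a⟩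
  · intro T b hb
    exact congrArg (fun q : T.unop.obj ⟶ Z.obj => q ≫ i.hom)
      (Category.comp_id (X := T.unop.obj) (Y := Z.obj) b)
  · intro T b hb
    have h : (⟨(ptsMap i).app T b, hb⟩ : (⟨X, A⟩ : Motive S).toPresheaf.obj T) =
      (ofSchemeIso i A hA).hom.app T ⟨b, trivial⟩ := rfl
    rw [h]
    have h1 := ConcreteCategory.congr_hom ((ofSchemeIso i A hA).hom_inv_id_app T)
      (⟨b, trivial⟩ : (ofScheme Z).toPresheaf.obj T)
    refine (congrArg Subtype.val h1).trans ?_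
    exact (Category.comp_id (X := T.unop.obj) (Y := Z.obj) b).symm

lemma motiveClass_eq_of_isoMotive {M N : Motive S} (h : IsoMotive M N) :
    motiveClass M = motiveClass N := by
  refine (QuotientAddGroup.eq_iff_sub_mem).2 ?_
  exact AddSubgroup.subset_closure (Rel.iso M N h)

lemma motiveClass_eq_schemeClass {X Z : SSch S} (i : Z ⟶ X) [IsClosedImmersion i.hom.left]
    (A : zariskiOn X) (hA : A.val = im i) : motiveClass ⟨X, A⟩ = schemeClass Z :=
  (motiveClass_eq_of_isoMotive (isoMotive_ofScheme i A hA)).symm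

lemma schemeClass_eq_of_iso {X Y : SSch S} (e : X ≅ Y) : schemeClass X = schemeClass Y := by
  have : IsIso e.hom.hom.left :=
    inferInstanceAs (IsIso (((isSScheme S).ι ⋙ Over.forget S).map e.hom))
  refine (motiveClass_eq_schemeClass e.hom (ofScheme Y).sieve ?_).symm
  refine (top_le_iff.1 fun T a _ => ?_).symm
  change T.unop.obj ⟶ Y.obj at a
  refine ⟨a ≫ e.inv.hom, ?_⟩
  change (a ≫ e.inv.hom) ≫ e.hom.hom = a
  rw [Category.assoc]
  exact (congrArg (a ≫ ·) (congrArg (·.hom) e.inv_hom_id)).trans (Category.comp_id _)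

lemma isValuation_motiveClass (X : SSch S) :
    IsValuation fun A : zariskiOn X => motiveClass ⟨X, A⟩ where
  map_bot := (QuotientAddGroup.eq_zero_iff _).2 (AddSubgroup.subset_closure (Rel.empty X))
  map_sup_add_inf A B := by
    refine ((QuotientAddGroup.eq_iff_sub_mem).2 ?_).symm
    rw [← sub_sub]
    exact AddSubgroup.subset_closure (Rel.scissor X A B)

/-- The class in the Grothendieck group of an isomorphism class of strongly connected schemes. -/
def scClass (c : SCClass S) : ZarGr S :=
  Quotient.lift (fun X : SCSch S => schemeClass X.val) 
    (fun _ _ (h : Nonempty _) => h.elim schemeClass_eq_of_iso) c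

end ClosedMotive

/-! ### The basis of strongly connected classes -/

section Basis

variable (S : Scheme.{u}) [JacobsonSpace S] [IsNoetherian S]

/-- The class map is itself a valuation on each ambient lattice, by the scissor and empty relations,
so inclusion-exclusion reduces to strongly connected pieces. -/
lemma span_range_scClass : Submodule.span ℤ (Set.range (scClass (S := S))) = ⊤ := by
  rw [eq_top_iff]
  rintro x -
  obtain ⟨x, rfl⟩ := QuotientAddGroup.mk_surjective x
  induction x using FreeAbelianGroup.induction_on with
  | zero => exact Submodule.zero_mem _
  | of M =>
    obtain ⟨s, hs, hsM⟩ := exists_finset_sup_eq M.sieve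
    have h := (isDecomposable_closedSieves M.amb).map_finset_sup_mem
      (isValuation_motiveClass M.amb)
      (H := (Submodule.span ℤ (Set.range (scClass (S := S)))).toAddSubgroup)
      (fun A ⟨Z, i, hZ, hi, hA⟩ => Submodule.subset_span
        ⟨Quotient.mk (scSetoid S) ⟨Z, hZ⟩, (motiveClass_eq_schemeClass i A hA).symm⟩) s hs
    rw [hsM] at h
    exact h
  | neg M h => exact Submodule.neg_mem _ h
  | add x y hx hy => exact Submodule.add_mem _ hx hy

/-- The coordinates of an element of the Grothendieck group with respect to the classes of the
strongly connected schemes. -/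
noncomputable def coordinates : ZarGr S →+ (SCClass S →₀ ℤ) :=
  QuotientAddGroup.lift _ (FreeAbelianGroup.lift fun M => classValuation M.amb M.sieve) <| by
    rw [AddSubgroup.closure_le]
    rintro r (⟨X, A, B⟩ | ⟨M, N, h⟩ | ⟨X⟩)
    · have h := (isValuation_classValuation X).map_sup_add_inf A B
      simp [AddMonoidHom.mem_ker, ← h]
    · simp [AddMonoidHom.mem_ker, classValuation_eq_of_isoMotive h]
    · exact (FreeAbelianGroup.lift_apply_of _ _).trans (isValuation_classValuation X).map_bot

lemma coordinates_scClass (c : SCClass S) : coordinates S (scClass c) = Finsupp.single c 1 := by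
  obtain ⟨X, rfl⟩ := Quotient.exists_rep c
  have h : coordinates S (scClass (Quotient.mk (scSetoid S) X)) =
      classValuation X.val (ofScheme X.val).sieve :=
    FreeAbelianGroup.lift_apply_of _ _
  rw [h]
  refine classValuation_eq_single X (𝟙 _) _ (inferInstanceAs (IsClosedImmersion (𝟙 _))) ?_
  refine (top_le_iff.1 fun T a _ => ?_).symm
  exact ⟨a, Category.comp_id (X := T.unop.obj) (Y := X.val.obj) a⟩

lemma linearIndependent_scClass : LinearIndependent ℤ (scClass (S := S)) := by
  refine LinearIndependent.of_comp (coordinates S).toIntLinearMap ?_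
  have h : (coordinates S).toIntLinearMap ∘ scClass = fun c => Finsupp.single c (1 : ℤ) :=
    funext (coordinates_scClass S)
  rw [h]
  exact Finsupp.linearIndependent_single_one ℤ _

/-- The classes of the strongly connected schemes form a basis of the Zariski Grothendieck
group. -/
noncomputable def scBasis : Module.Basis (SCClass S) ℤ (ZarGr S) :=
  Module.Basis.mk (linearIndependent_scClass S) (span_range_scClass S).ge

lemma scBasis_apply (c : SCClass S) : scBasis S c = scClass c :=
  Module.Basis.mk_apply _ _ c

end Basis

end Motivic

theorem theoremT (S : AlgebraicGeometry.Scheme.{u}) [AlgebraicGeometry.IsNoetherian S]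
    [JacobsonSpace S] :
    (∃ b : Module.Basis (Motivic.SCClass S) ℤ (Motivic.ZarGr S),
      ∀ X : Motivic.SCSch S,
        b (Quotient.mk (Motivic.scSetoid S) X) = Motivic.schemeClass X.val) ∧
    ∀ X Y : Motivic.SSch S,
      Motivic.StronglyConnected X.obj.left → Motivic.StronglyConnected Y.obj.left →
        (Motivic.schemeClass X = Motivic.schemeClass Y ↔ Nonempty (X ≅ Y)) := by
  refine ⟨⟨Motivic.scBasis S, fun X => Motivic.scBasis_apply S _⟩, fun X Y hX hY =>
    ⟨fun h => ?_, fun ⟨e⟩ => Motivic.schemeClass_eq_of_iso e⟩⟩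
  have h1 := (Motivic.linearIndependent_scClass S).injective
    (a₁ := Quotient.mk (Motivic.scSetoid S) ⟨X, hX⟩)
    (a₂ := Quotient.mk (Motivic.scSetoid S) ⟨Y, hY⟩) h
  exact Quotient.exact h1
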